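/- Let $k$ and $n$ be positive integers with $k \le n$, and let $\sigma,\tau$ be independent uniformly random $n$-cycles in the symmetric group $S_n$ (for $n=1$ the identity counts as a $1$-cycle). The probability that $1,2,\dots,k$ all lie in the same cycle of the product $\sigma\tau$ is \[\frac{1}{k} + \frac{4(-1)^n}{\binom{2k}{k}} \sum_{\substack{1\le i\le k-1\\ i\not\equiv n \bmod 2}} \binom{2k-1}{k+i}\left(\frac{1}{n+i+1}-\frac{1}{n-i}\right).\] In particular, for each fixed $k\ge 1$ and each parity class of $n$, this probability is a rational function of $n(n+1)$: there are polynomials $P,Q$ with rational coefficients, depending only on $k$ and the parity of $n$, such that for all $n\ge k$ of that parity $Q(n(n+1))\ne 0$ and the probability equals $P(n(n+1))/Q(n(n+1))$. -/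

import Mathlib

namespace CycleProduct

open Classical in
/-- The set of `n`-cycles of the symmetric group on `Fin n` (the letters `1, …, n` are
represented by `0, …, n - 1`): the permutations all of whose letters lie in one cycle.
For `n = 1` this is the identity, which `Equiv.Perm.IsCycle` would exclude. -/
noncomputable def nCycles (n : ℕ) : Finset (Equiv.Perm (Fin n)) :=
  Finset.univ.filter fun σ => σ.IsCycleOn Set.univ

theorem nCycles_nonempty (n : ℕ) : (nCycles n).Nonempty := by
  classical
  refine ⟨finRotate n, ?_⟩
  simp only [nCycles, Finset.mem_filter, Finset.mem_univ, true_and]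
  match n with
  | 0 => exact ⟨(Equiv.bijective _).bijOn_univ, fun x => x.elim0⟩
  | 1 =>
    refine ⟨(Equiv.bijective _).bijOn_univ, fun x _ y _ => ?_⟩
    rw [Subsingleton.elim x y]
  | m + 2 =>
    have h := (isCycle_finRotate (n := m)).isCycleOn
    have hs : {x | finRotate (m + 2) x ≠ x} = Set.univ := by
      have h2 := support_finRotate (n := m)
      ext x
      have hx : x ∈ (finRotate (m + 2)).support := by rw [h2]; exact Finset.mem_univ x
      exact iff_of_true (Equiv.Perm.mem_support.mp hx) (Set.mem_univ x)
    rwa [hs] at h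

/-- The law of a uniformly random `n`-cycle. -/
noncomputable def randomNCycle (n : ℕ) : PMF (Equiv.Perm (Fin n)) :=
  PMF.uniformOfFinset (nCycles n) (nCycles_nonempty n)

/-- The law of the product `σ * τ` of two independent uniformly random `n`-cycles. -/
noncomputable def randomProduct (n : ℕ) : PMF (Equiv.Perm (Fin n)) :=
  (randomNCycle n).bind fun σ => (randomNCycle n).map fun τ => σ * τ

/-- The first `k` letters all lie in the same cycle of `π`; a fixed letter is a cycle by itself. -/
def Coalesce {n : ℕ} (k : ℕ) (π : Equiv.Perm (Fin n)) : Prop :=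
  ∀ i j : Fin n, (i : ℕ) < k → (j : ℕ) < k → π.SameCycle i j

/-- The probability that the first `k` letters lie in the same cycle of a product of two
independent uniformly random `n`-cycles. -/
noncomputable def coalescenceProb (n k : ℕ) : ℝ :=
  ((randomProduct n).toOuterMeasure {π | Coalesce k π}).toReal

end CycleProduct

/-!
For a permutation `w` of `n` letters with permutation matrix `P` let
`D_w(t) = det ((1 - t) I + t P)`. By Boccara's formula the number of ways to write `w` as a product
of two `n`-cycles is `(n - 1)! ∫₀¹ D_w(t) dt` (`factorizationCount_eq_integral`). It is proved by
inserting a new letter into `w`. If the new letter is a fixed letter, both sides are multiplied by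
`n`. If `w` is obtained from `v` by inserting it before `q`, deleting it from the two factors shows
that the number of factorizations of `w` is the sum of those of `(i q) v` over `i ≠ q`
(`factorizationCount_swap_none_mul_optionCongr`). The determinants of these permutations are
expressed through `D_v`, one diagonal entry of the adjugate of the matrix of `v`, and the trace of
that adjugate (`sum_pencilDet_swap_mul`, `pencilDet_swap_none_mul_optionCongr`); this uses that all
row and column sums of the matrix are `1`. Jacobi's formula turns the trace into a derivative, and
what remains under the integral sign is the derivative of `t (1 - t) D_v(t)`.

Let `G_K` be the sum of `D_w` over the `w` that have all letters of a `k`-set `K` in one cycle. The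
same insertion identities give `G_K` for `n + 1` letters as a first-order differential operator
applied to `G_K` for `n` letters (`pencilDetSum_map_some`), with initial value
`(k - 1)! ((1 - t) ^ k - (-t) ^ k)` at `n = k` (`pencilDetSum_univ`). This yields the expansion of
`G_K` in the functions `t ^ m (1 - t) ^ (n - m)` (`pencilDetSum_eq_formula`), and integration
expresses the coalescence probability `p_k` by a single alternating sum
(`coalescenceProb_add_two`). Telescoping gives the recursion

`(n (n + 1) - k (k + 1)) p_{k+1} + k (k + 1) p_k = n (n + 1) / (k + 1) - (-1) ^ n k`

(`coalescenceProb_succ`). The closed formula satisfies it too (`closedSum_succ`), and both sides are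
`1` for `k = 1`. Rationality in `n (n + 1)` follows from
`1 / (n + i + 1) - 1 / (n - i) = -(2 i + 1) / (n (n + 1) - i (i + 1))`.
-/

namespace CycleProduct

open Equiv Finset

/-! ### Determinants of pencils of permutation matrices -/

section pencil
open Matrix
variable {α : Type*} [DecidableEq α]

/-- The matrix `(1 - t) I + t P`, where `P` is the permutation matrix of `w`. -/
def pencil (w : Perm α) (t : ℝ) : Matrix α α ℝ :=
  of fun x y => (1 - t) * (if x = y then 1 else 0) + t * (if w x = y then 1 else 0)

theorem pencil_optionCongr_none (v : Perm α) (t : ℝ) :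
    pencil v.optionCongr t none = Pi.single none 1 := by
  ext y
  cases y <;> simp [pencil, of_apply]

theorem pencil_optionCongr_some (v : Perm α) (t : ℝ) :
    (pencil v.optionCongr t).submatrix some some = pencil v t := by
  ext x y
  simp [pencil]

variable [Fintype α]

/-- Exchanging two columns of a matrix up to an error `d` that is subtracted from one column and
added to the other: besides the sign of the exchange only terms linear in `d` survive, since the
quadratic term has two equal columns. -/
theorem det_updateCol_updateCol_exchange (A : Matrix α α ℝ) {i q : α} (h : i ≠ q) (d : α → ℝ) :
    ((A.updateCol i ((fun x => A x q) + d)).updateCol q ((fun x => A x i) - d)).det =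
      -A.det + (A.adjugate *ᵥ d) i - (A.adjugate *ᵥ d) q := by
  have hc : ∀ u v : α → ℝ, ((A.updateCol i u).updateCol q v).det =
      ((A.updateCol q v).updateCol i u).det := fun u v => by rw [updateCol_comm _ h]
  have hsw : ∀ u v : α → ℝ, ((A.updateCol i u).updateCol q v).det =
      -((A.updateCol i v).updateCol q u).det := by
    intro u v
    have := det_permute' (swap i q) ((A.updateCol i v).updateCol q u)
    rw [Perm.sign_swap h] at this
    simp only [Units.val_neg, Units.val_one, Int.cast_neg, Int.cast_one, neg_mul, one_mul] at this
    rw [← this]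
    congr 1
    ext x y
    simp only [submatrix_apply, id, updateCol_apply, swap_apply_def]
    split_ifs <;> simp_all
  have hself : ((A.updateCol i (fun x => A x i)).updateCol q (fun x => A x q)).det = A.det := by
    congr 1
    ext x y
    rcases eq_or_ne y q with rfl | hq
    · simp
    · rcases eq_or_ne y i with rfl | hi <;> simp [*]
  have hd : ∀ j, (A.updateCol j d).det = (A.adjugate *ᵥ d) j := by
    intro j
    rw [← cramer_eq_adjugate_mulVec, cramer_apply]
  have h1 : ((A.updateCol i d).updateCol q (fun x => A x q)).det = (A.adjugate *ᵥ d) i := by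
    rw [← hd]
    congr 1
    ext x y
    rcases eq_or_ne y q with rfl | hq
    · simp [h.symm]
    · rcases eq_or_ne y i with rfl | hi <;> simp [*]
  have h2 : ((A.updateCol i (fun x => A x i)).updateCol q d).det = (A.adjugate *ᵥ d) q := by
    rw [← hd]
    congr 1
    ext x y
    rcases eq_or_ne y q with rfl | hq
    · simp
    · rcases eq_or_ne y i with rfl | hi <;> simp [*]
  have hneg : ∀ u : α → ℝ, ((A.updateCol i u).updateCol q (-d)).det =
      -((A.updateCol i u).updateCol q d).det := by
    intro u
    have := det_updateCol_smul (A.updateCol i u) q (-1) d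
    simpa using this
  have h0 : ((A.updateCol i d).updateCol q d).det = 0 :=
    det_zero_of_column_eq h fun x => by simp [updateCol_apply]
  rw [sub_eq_add_neg, det_updateCol_add, hneg, hc, hc _ d, det_updateCol_add, det_updateCol_add,
    ← hc, ← hc, ← hc, ← hc, h0, hsw _ (fun x => A x i), hself, hsw d (fun x => A x i), h2,
    hsw _ d, h1]
  ring

/-- The determinant of `(1 - t) I + t P`, where `P` is the permutation matrix of `w`; it equals
the product of `(1 - t) ^ l - (-t) ^ l` over the cycle lengths `l` of `w`. -/
noncomputable def pencilDet (w : Perm α) (t : ℝ) : ℝ := (pencil w t).det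

theorem pencil_mulVec_one (w : Perm α) (t : ℝ) : pencil w t *ᵥ 1 = 1 := by
  ext x
  simp [pencil, mulVec, dotProduct, sum_add_distrib]

theorem one_vecMul_pencil (w : Perm α) (t : ℝ) : 1 ᵥ* pencil w t = 1 := by
  ext x
  have : ∀ y, (w y = x) = (y = w.symm x) := fun y => by
    rw [Equiv.eq_symm_apply]
  simp [pencil, vecMul, dotProduct, sum_add_distrib, this]

/-- The pencil has row sums `1`, so multiplying `adj A * A = det A` by the all-ones vector shows
that the row sums of the adjugate are `det A`. -/
theorem sum_adjugate_pencil_row (w : Perm α) (t : ℝ) (x : α) :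
    ∑ y, (pencil w t).adjugate x y = pencilDet w t := by
  have h : (pencil w t).adjugate *ᵥ (pencil w t *ᵥ 1) = pencilDet w t • 1 := by
    rw [mulVec_mulVec, adjugate_mul, smul_mulVec, one_mulVec]; rfl
  rw [pencil_mulVec_one] at h
  have := congrFun h x
  simpa [mulVec, dotProduct] using this

theorem sum_adjugate_pencil_col (w : Perm α) (t : ℝ) (y : α) :
    ∑ x, (pencil w t).adjugate x y = pencilDet w t := by
  have h : (1 ᵥ* pencil w t) ᵥ* (pencil w t).adjugate = pencilDet w t • 1 := by
    rw [vecMul_vecMul, mul_adjugate, vecMul_smul, vecMul_one]; rfl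
  rw [one_vecMul_pencil] at h
  have := congrFun h y
  simpa [vecMul, dotProduct] using this

/-- Composing `w` with a transposition exchanges two columns of `t P` but not of `(1 - t) I`; the
discrepancy is `(1 - t)` times a difference of two unit vectors. -/
theorem pencilDet_swap_mul (w : Perm α) (t : ℝ) {i q : α} (h : i ≠ q) :
    pencilDet (swap i q * w) t = -pencilDet w t + (1 - t) *
      ((pencil w t).adjugate q q + (pencil w t).adjugate i i
        - (pencil w t).adjugate q i - (pencil w t).adjugate i q) := by
  have key := det_updateCol_updateCol_exchange (pencil w t) h
    ((1 - t) • (Pi.single i 1 - Pi.single q 1))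
  rw [pencilDet]
  convert key using 1
  · congr 1
    ext x y
    have e : (swap i q (w x) = y) = (w x = swap i q y) := by
      rw [swap_apply_eq_iff]
    simp only [pencil, of_apply, Perm.mul_apply, e, updateCol_apply, Pi.add_apply, Pi.sub_apply,
      Pi.smul_apply, Pi.single_apply, smul_eq_mul]
    by_cases hq : y = q
    · subst hq; simp; split_ifs <;> ring
    · by_cases hi : y = i
      · subst hi; simp [h]; split_ifs <;> ring
      · simp [hq, hi, swap_apply_of_ne_of_ne hi hq]
  · simp only [mulVec_smul, mulVec_sub, mulVec_single_one, Pi.smul_apply, Pi.sub_apply, col_apply,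
      smul_eq_mul, pencilDet]
    ring

/-- Jacobi's formula for the derivative of the determinant. -/
theorem hasDerivAt_pencilDet (w : Perm α) (t : ℝ) :
    HasDerivAt (pencilDet w)
      (((pencil w t).adjugate * (of fun x y => -(if x = y then 1 else 0) +
        (if w x = y then 1 else 0))).trace) t := by
  have h1 : ∀ x y, HasDerivAt (fun s => pencil w s x y)
      ((of fun x y => -(if x = y then (1:ℝ) else 0) + (if w x = y then 1 else 0) :
        Matrix α α ℝ) x y) t := by
    intro x y
    simp only [pencil, of_apply]
    have a1 := ((hasDerivAt_id t).const_sub 1).mul_const (if x = y then (1:ℝ) else 0)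
    have a2 := (hasDerivAt_id t).mul_const (if w x = y then (1:ℝ) else 0)
    exact (a1.add a2).congr_deriv (by ring)
  generalize (of fun x y => -(if x = y then (1:ℝ) else 0) + (if w x = y then 1 else 0) :
        Matrix α α ℝ) = B at h1
  have h2 : HasDerivAt (pencilDet w) (∑ σ : Perm α, (Perm.sign σ : ℝ) *
      ∑ y, (∏ z ∈ univ.erase y, pencil w t (σ z) z) • B (σ y) y) t := by
    have : pencilDet w = fun s => ∑ σ : Perm α, (Perm.sign σ : ℝ) * ∏ y, pencil w s (σ y) y := by
      ext s
      rw [pencilDet, det_apply']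
    rw [this]
    refine HasDerivAt.fun_sum fun σ _ => HasDerivAt.const_mul _ ?_
    exact HasDerivAt.fun_finsetProd fun y _ => h1 (σ y) y
  convert h2 using 1
  have h3 : ∀ y, ((pencil w t).adjugate * B) y y = ∑ σ : Perm α, (Perm.sign σ : ℝ) *
      ((∏ z ∈ univ.erase y, pencil w t (σ z) z) * B (σ y) y) := by
    intro y
    have : ((pencil w t).adjugate * B) y y = ((pencil w t).adjugate *ᵥ (fun x => B x y)) y := rfl
    rw [this, ← cramer_eq_adjugate_mulVec, cramer_apply, det_apply']
    refine sum_congr rfl fun σ _ => ?_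
    congr 1
    rw [← mul_prod_erase _ _ (mem_univ y), mul_comm]
    congr 1
    · refine prod_congr rfl fun z hz => ?_
      rw [updateCol_ne (ne_of_mem_erase hz)]
    · simp
  simp only [trace, diag_apply, h3, mul_sum, smul_eq_mul]
  rw [sum_comm]

/-- Jacobi's formula, rewritten so that the derivative `d` of the determinant determines the trace
of the adjugate. -/
theorem exists_hasDerivAt_pencilDet (w : Perm α) (t : ℝ) :
    ∃ d, HasDerivAt (pencilDet w) d t ∧
      (pencil w t).adjugate.trace = Fintype.card α * pencilDet w t - t * d := by
  refine ⟨_, hasDerivAt_pencilDet w t, ?_⟩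
  have hB : pencil w t = 1 + t • (of fun x y => -(if x = y then (1:ℝ) else 0) +
        (if w x = y then 1 else 0)) := by
    ext x y
    simp only [pencil, of_apply, Matrix.add_apply, Matrix.smul_apply, one_apply, smul_eq_mul]
    ring
  generalize (of fun x y => -(if x = y then (1:ℝ) else 0) + (if w x = y then 1 else 0) :
        Matrix α α ℝ) = B at hB
  have h1 := congrArg trace (adjugate_mul (pencil w t))
  nth_rw 2 [hB] at h1
  rw [mul_add, mul_one, Matrix.mul_smul, trace_add, trace_smul, trace_smul, trace_one] at h1
  simp only [smul_eq_mul] at h1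
  rw [pencilDet]
  linarith

theorem continuous_pencilDet (w : Perm α) : Continuous (pencilDet w) :=
  continuous_iff_continuousAt.2 fun t => (hasDerivAt_pencilDet w t).continuousAt

/-- The sum over all transpositions that move `q` depends on `w` only through the determinant, one
diagonal entry of the adjugate and its trace. -/
theorem sum_pencilDet_swap_mul (w : Perm α) (t : ℝ) (q : α) :
    ∑ i ∈ univ.erase q, pencilDet (swap i q * w) t =
      -(Fintype.card α - 1) * pencilDet w t + (1 - t) *
        (Fintype.card α * (pencil w t).adjugate q q + (pencil w t).adjugate.trace
          - 2 * pencilDet w t) := by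
  have h : ∀ i ∈ univ.erase q, pencilDet (swap i q * w) t = -pencilDet w t + (1 - t) *
      ((pencil w t).adjugate q q + (pencil w t).adjugate i i
        - (pencil w t).adjugate q i - (pencil w t).adjugate i q) := fun i hi =>
    pencilDet_swap_mul w t (ne_of_mem_erase hi)
  rw [sum_congr rfl h, ← add_right_inj (-pencilDet w t + (1 - t) *
      ((pencil w t).adjugate q q + (pencil w t).adjugate q q
        - (pencil w t).adjugate q q - (pencil w t).adjugate q q)),
    add_sum_erase univ (fun i => -pencilDet w t + (1 - t) *
      ((pencil w t).adjugate q q + (pencil w t).adjugate i i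
        - (pencil w t).adjugate q i - (pencil w t).adjugate i q)) (mem_univ q)]
  simp only [sum_add_distrib, ← mul_sum, sum_sub_distrib, sum_adjugate_pencil_row,
    sum_adjugate_pencil_col, sum_const, card_univ, nsmul_eq_mul, trace, diag_apply]
  ring

theorem det_option_of_row_none (M : Matrix (Option α) (Option α) ℝ)
    (h : M none = Pi.single none 1) : M.det = (M.submatrix some some).det := by
  rw [← det_submatrix_equiv_self (optionEquivSumPUnit.{0} α).symm M,
    ← fromBlocks_toBlocks (M.submatrix _ _)]
  have : (M.submatrix (optionEquivSumPUnit.{0} α).symm (optionEquivSumPUnit.{0} α).symm).toBlocks₂₁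
      = 0 := by
    ext x y
    simp [toBlocks₂₁, h]
  rw [this, det_fromBlocks_zero₂₁]
  have h2 : (M.submatrix (optionEquivSumPUnit.{0} α).symm
      (optionEquivSumPUnit.{0} α).symm).toBlocks₂₂.det = 1 := by
    rw [det_unique]
    simp [toBlocks₂₂, h]
  rw [h2, mul_one]
  congr 1

theorem pencilDet_optionCongr (v : Perm α) (t : ℝ) :
    pencilDet v.optionCongr t = pencilDet v t := by
  rw [pencilDet, det_option_of_row_none _ (pencil_optionCongr_none v t),
    pencil_optionCongr_some, pencilDet]

/-- The permutation `swap none (some q) * v.optionCongr` is `v` with the new letter `none` inserted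
into the cycle of `q`, just before `q`. -/
theorem pencilDet_swap_none_mul_optionCongr (v : Perm α) (t : ℝ) (q : α) :
    pencilDet (swap none (some q) * v.optionCongr) t =
      (1 - t) * (pencil v t).adjugate q q - t * pencilDet v t := by
  rw [pencilDet_swap_mul _ _ (by simp), pencilDet_optionCongr]
  have h00 : (pencil v.optionCongr t).adjugate none none = pencilDet v t := by
    rw [adjugate_apply, ← pencil_optionCongr_none v t, updateRow_eq_self]
    exact pencilDet_optionCongr v t
  have hqq : (pencil v.optionCongr t).adjugate (some q) (some q) = (pencil v t).adjugate q q := by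
    rw [adjugate_apply, det_option_of_row_none, adjugate_apply]
    · congr 1
      ext x y
      rw [← pencil_optionCongr_some v t]
      simp only [submatrix_apply, updateRow_apply, Option.some.injEq, Pi.single_apply]
    · ext y
      rw [updateRow_ne (by simp), pencil_optionCongr_none]
  have h0q : (pencil v.optionCongr t).adjugate none (some q) = 0 := by
    rw [adjugate_apply]
    refine det_zero_of_row_eq (i := none) (j := some q) (by simp) ?_
    rw [updateRow_ne (by simp), pencil_optionCongr_none, updateRow_self]
  have hq0 : (pencil v.optionCongr t).adjugate (some q) none = 0 := by
    rw [adjugate_apply]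
    refine det_eq_zero_of_column_eq_zero none fun x => ?_
    cases x with
    | none => simp
    | some x => simp [updateRow_apply, pencil]
  rw [h00, hqq, h0q, hq0]
  ring

theorem pencilDet_permCongr {β : Type*} [Fintype β] [DecidableEq β] (e : α ≃ β) (w : Perm α)
    (t : ℝ) : pencilDet (e.permCongr w) t = pencilDet w t := by
  rw [pencilDet, ← det_submatrix_equiv_self e, pencilDet]
  congr 1
  ext x y
  simp [pencil]

end pencil

/-! ### Inserting a letter into a permutation -/

/-- All the letters of `K` lie in one cycle of `w`, a fixed letter being a cycle by itself. For
`K = univ` this says that `w` is a cycle on all the letters. -/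
def InOneCycle {α : Type*} (K : Finset α) (w : Perm α) : Prop :=
  ∀ x ∈ K, ∀ y ∈ K, w.SameCycle x y

section cycles
variable {α : Type*}

theorem inOneCycle_inv {K : Finset α} {w : Perm α} : InOneCycle K w⁻¹ ↔ InOneCycle K w := by
  simp [InOneCycle, Perm.sameCycle_inv]

theorem sameCycle_permCongr {β : Type*} (e : α ≃ β) (w : Perm α) (x y : α) :
    (e.permCongr w).SameCycle (e x) (e y) ↔ w.SameCycle x y := by
  have h : ∀ n : ℤ, (e.permCongr w) ^ n = e.permCongr (w ^ n) := fun n =>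
    (map_zpow e.permCongrHom w n).symm
  simp [Perm.SameCycle, h]

theorem inOneCycle_map_permCongr {β : Type*} (e : α ≃ β) (K : Finset α) (w : Perm α) :
    InOneCycle (K.map e.toEmbedding) (e.permCongr w) ↔ InOneCycle K w := by
  simp only [InOneCycle, forall_mem_map, coe_toEmbedding, sameCycle_permCongr]

theorem inOneCycle_univ_permCongr {β : Type*} [Fintype α] [Fintype β] (e : α ≃ β) (w : Perm α) :
    InOneCycle univ (e.permCongr w) ↔ InOneCycle univ w := by
  rw [← inOneCycle_map_permCongr e, map_univ_equiv]

theorem optionCongr_mul (u v : Perm α) :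
    (u * v).optionCongr = u.optionCongr * v.optionCongr := by
  ext1 x
  cases x <;> rfl

variable [DecidableEq α]

theorem swap_none_mul_optionCongr (v : Perm α) (i : α) :
    swap none (some i) * v.optionCongr = v.optionCongr * swap none (some (v⁻¹ i)) := by
  rw [swap_mul_eq_mul_swap]
  rfl

/-- Inserting a new letter, in any position, does not change which old letters share a cycle. -/
theorem sameCycle_swap_none_mul_optionCongr [Finite α] (i : Option α) (v : Perm α) (x y : α) :
    (swap none i * v.optionCongr).SameCycle (some x) (some y) ↔ v.SameCycle x y := by
  set w := swap none i * v.optionCongr with hw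
  have hsome : ∀ z, some (v z) ≠ i → w (some z) = some (v z) := fun z hz => by
    simp [hw, swap_apply_of_ne_of_ne, hz]
  have hjump : ∀ z, some (v z) = i → w (some z) = none := fun z hz => by
    simp [hw, ← hz]
  have hnone : w none = i := by simp [hw]
  constructor
  · intro h
    obtain ⟨n, hn⟩ := h.exists_nat_pow_eq
    have key : ∀ n : ℕ, (∀ z, (w ^ n) (some x) = some z → v.SameCycle x z) ∧
        ((w ^ n) (some x) = none → ∀ q, i = some q → v.SameCycle x q) := by
      intro n
      induction n with
      | zero => exact ⟨fun z hz => by cases hz; rfl, fun hz => by cases hz⟩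
      | succ n ih =>
        rw [pow_succ', Perm.mul_apply]
        rcases hz : (w ^ n) (some x) with _ | z
        · rw [hnone]
          refine ⟨fun q hq => ih.2 hz q hq, ?_⟩
          rintro rfl q hq
          cases hq
        · have hs := (ih.1 z hz).apply_right
          by_cases hi : some (v z) = i
          · rw [hjump z hi]
            refine ⟨by simp, fun _ q hq => ?_⟩
            rw [hq] at hi
            cases hi
            exact hs
          · rw [hsome z hi]
            simpa using hs
    exact (key n).1 y hn
  · intro h
    obtain ⟨n, rfl⟩ := h.exists_nat_pow_eq
    induction n with
    | zero => rfl
    | succ n ih =>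
      rw [pow_succ', Perm.mul_apply]
      refine (ih ⟨n, by simp⟩).trans ?_
      by_cases hi : some (v ((v ^ n) x)) = i
      · rw [hi, ← hnone, ← hjump _ hi]
        exact ⟨2, rfl⟩
      · rw [← hsome _ hi]
        exact ⟨1, rfl⟩

theorem inOneCycle_map_some_swap_none_mul_optionCongr [Finite α] (i : Option α) (v : Perm α)
    (K : Finset α) :
    InOneCycle (K.map Function.Embedding.some) (swap none i * v.optionCongr) ↔ InOneCycle K v := by
  simp [InOneCycle, sameCycle_swap_none_mul_optionCongr]

variable [Fintype α]

theorem inOneCycle_univ_swap_none_mul_optionCongr [Nonempty α] (i : Option α) (v : Perm α) :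
    InOneCycle univ (swap none i * v.optionCongr) ↔ i ≠ none ∧ InOneCycle univ v := by
  simp only [InOneCycle, mem_univ, true_imp_iff]
  constructor
  · intro h
    refine ⟨?_, fun x y => (sameCycle_swap_none_mul_optionCongr i v x y).1 (h _ _)⟩
    rintro rfl
    obtain ⟨x⟩ := ‹Nonempty α›
    obtain ⟨n, hn⟩ := (h none (some x)).exists_nat_pow_eq
    have : ∀ n : ℕ, ((swap none none * v.optionCongr : Perm (Option α)) ^ n) none = none := by
      intro n
      induction n with
      | zero => rfl
      | succ n ih => rw [pow_succ', Perm.mul_apply, ih]; simp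
    rw [this] at hn
    cases hn
  · rintro ⟨hi, h⟩
    obtain ⟨q, rfl⟩ := Option.ne_none_iff_exists'.1 hi
    have hs : ∀ x y, (swap none (some q) * v.optionCongr).SameCycle (some x) (some y) :=
      fun x y => (sameCycle_swap_none_mul_optionCongr _ v x y).2 (h x y)
    have hn : (swap none (some q) * v.optionCongr).SameCycle none (some q) :=
      ⟨1, by simp⟩
    rintro (_ | x) (_ | y)
    · rfl
    · exact hn.trans (hs _ _)
    · exact (hn.trans (hs _ _)).symm
    · exact hs x y

theorem inOneCycle_univ_optionCongr_mul_swap_none [Nonempty α] (i : Option α) (v : Perm α) :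
    InOneCycle univ (v.optionCongr * swap none i) ↔ i ≠ none ∧ InOneCycle univ v := by
  rw [← inOneCycle_inv, mul_inv_rev, swap_inv, ← inOneCycle_inv (w := v),
    ← inOneCycle_univ_swap_none_mul_optionCongr]
  rfl

theorem inOneCycle_univ_optionCongr [Nonempty α] (v : Perm α) :
    ¬ InOneCycle univ v.optionCongr := by
  have := inOneCycle_univ_swap_none_mul_optionCongr none v
  simpa [swap_self, Perm.one_def.symm] using this

open Classical in
/-- The number of ways to write `w` as a product `σ * τ` of two permutations that have all the
letters in one cycle. -/
noncomputable def factorizationCount (w : Perm α) : ℕ :=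
  ∑ σ : Perm α, if InOneCycle univ σ ∧ InOneCycle univ (σ⁻¹ * w) then 1 else 0

theorem factorizationCount_permCongr {β : Type*} [Fintype β] [DecidableEq β] (e : α ≃ β)
    (w : Perm α) : factorizationCount (e.permCongr w) = factorizationCount w := by
  classical
  rw [factorizationCount, ← e.permCongr.sum_comp]
  refine sum_congr rfl fun σ _ => ?_
  have : (e.permCongr σ)⁻¹ * e.permCongr w = e.permCongr (σ⁻¹ * w) := by
    have h1 := map_mul e.permCongrHom σ⁻¹ w
    rw [map_inv] at h1
    exact h1.symm
  rw [this]
  simp only [inOneCycle_univ_permCongr]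

/-- A permutation of `Option α` arises from exactly one permutation of `α`, by adding `none` as a
fixed letter or by inserting it before some letter `q`. -/
theorem sum_perm_option {M : Type*} [AddCommMonoid M] (f : Perm (Option α) → M) :
    ∑ w, f w = ∑ v : Perm α, (f v.optionCongr + ∑ q, f (swap none (some q) * v.optionCongr)) := by
  rw [← Perm.decomposeOption.symm.sum_comp, Fintype.sum_prod_type_right]
  refine sum_congr rfl fun v _ => ?_
  rw [Fintype.sum_option]
  simp [Perm.decomposeOption, swap_self, Perm.one_def.symm]

theorem factorizationCount_optionCongr [Nonempty α] (v : Perm α) :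
    factorizationCount v.optionCongr = Fintype.card α * factorizationCount v := by
  classical
  rw [factorizationCount, sum_perm_option, factorizationCount, mul_sum]
  refine sum_congr rfl fun σ _ => ?_
  have h : ∀ i, (swap none (some i) * σ.optionCongr)⁻¹ * v.optionCongr =
      (σ⁻¹ * v).optionCongr * swap none (some (v⁻¹ i)) := by
    intro i
    rw [mul_inv_rev, swap_inv, mul_assoc, swap_none_mul_optionCongr, optionCongr_mul, mul_assoc]
    rfl
  simp only [h, inOneCycle_univ_optionCongr, inOneCycle_univ_swap_none_mul_optionCongr,
    inOneCycle_univ_optionCongr_mul_swap_none, false_and, if_false, zero_add, ne_eq,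
    reduceCtorEq, not_false_eq_true, true_and, sum_const, card_univ, smul_eq_mul]

/-- If `w` is `v` with a new letter inserted before `q`, then deleting the new letter from both
factors of `w = σ * τ` turns them into factors of `swap i q * v`, where `i` is the letter that
follows the new one in `σ`. -/
theorem factorizationCount_swap_none_mul_optionCongr [Nonempty α] (v : Perm α) (q : α) :
    factorizationCount (swap none (some q) * v.optionCongr) =
      ∑ i ∈ univ.erase q, factorizationCount (swap i q * v) := by
  classical
  rw [factorizationCount, sum_perm_option]
  simp only [factorizationCount]
  rw [sum_comm]
  refine sum_congr rfl fun σ _ => ?_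
  have h : ∀ i, i ≠ q →
      (swap none (some i) * σ.optionCongr)⁻¹ * (swap none (some q) * v.optionCongr) =
      (σ⁻¹ * (swap i q * v)).optionCongr * swap none (some (v⁻¹ i)) := by
    intro i hi
    have e : swap none (some i) * swap none (some q) =
        (swap i q).optionCongr * swap none (some i) := by
      rw [mul_swap_eq_swap_mul, optionCongr_swap, swap_apply_left,
        swap_apply_of_ne_of_ne (by simp) (by simpa using hi.symm)]
    rw [mul_inv_rev, swap_inv, mul_assoc, ← mul_assoc (swap _ _) (swap _ _), e, mul_assoc,
      swap_none_mul_optionCongr, optionCongr_mul, optionCongr_mul, mul_assoc, mul_assoc]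
    rfl
  -- For `i = q` the second factor fixes `none`, so it is not a full cycle.
  have hq : (swap none (some q) * σ.optionCongr)⁻¹ * (swap none (some q) * v.optionCongr) =
      (σ⁻¹ * v).optionCongr := by
    rw [mul_inv_rev, swap_inv, mul_assoc, swap_mul_self_mul]
    exact (optionCongr_mul σ⁻¹ v).symm
  rw [← add_sum_erase _ _ (mem_univ q), hq]
  simp only [inOneCycle_univ_optionCongr, false_and, and_false, if_false, zero_add]
  refine sum_congr rfl fun i hi => ?_
  rw [h i (ne_of_mem_erase hi)]
  simp only [inOneCycle_univ_swap_none_mul_optionCongr,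
    inOneCycle_univ_optionCongr_mul_swap_none, ne_eq,
    reduceCtorEq, not_false_eq_true, true_and]

end cycles

/-! ### Boccara's formula and its summation -/

open Nat

theorem inOneCycle_of_subsingleton {α : Type*} [Subsingleton α] (K : Finset α) (w : Perm α) :
    InOneCycle K w := fun x _ y _ => by
  rw [Subsingleton.elim x y]

section count
variable {α : Type*} [Fintype α] [DecidableEq α]

/-- The two sides of the recursion for the number of factorizations differ, under the integral
sign, by the derivative of a function that vanishes at `0` and at `1`. -/
theorem hasDerivAt_mul_one_sub_mul_pencilDet (v : Perm α) (q : α) (t : ℝ) :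
    HasDerivAt (fun t => t * (1 - t) * pencilDet v t)
      (Fintype.card α * pencilDet (swap none (some q) * v.optionCongr) t -
        ∑ i ∈ univ.erase q, pencilDet (swap i q * v) t) t := by
  obtain ⟨d, hd, htr⟩ := exists_hasDerivAt_pencilDet v t
  have h1 : HasDerivAt (fun t : ℝ => t * (1 - t)) (1 - 2 * t) t := by
    have := (hasDerivAt_id t).mul ((hasDerivAt_id t).const_sub 1)
    exact this.congr_deriv (by simp; ring)
  refine (h1.mul hd).congr_deriv ?_
  rw [sum_pencilDet_swap_mul, pencilDet_swap_none_mul_optionCongr, htr]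
  ring

theorem card_mul_integral_pencilDet_swap_none (v : Perm α) (q : α) :
    Fintype.card α * ∫ t in (0:ℝ)..1, pencilDet (swap none (some q) * v.optionCongr) t =
      ∑ i ∈ univ.erase q, ∫ t in (0:ℝ)..1, pencilDet (swap i q * v) t := by
  have hc : ∀ {β : Type _} [Fintype β] [DecidableEq β] (w : Perm β),
      IntervalIntegrable (pencilDet w) MeasureTheory.volume 0 1 := fun w =>
    (continuous_pencilDet w).intervalIntegrable _ _
  have hs : IntervalIntegrable (fun t => ∑ i ∈ univ.erase q, pencilDet (swap i q * v) t)
      MeasureTheory.volume 0 1 :=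
    (continuous_finsetSum _ fun i _ => continuous_pencilDet _).intervalIntegrable _ _
  have h := intervalIntegral.integral_eq_sub_of_hasDerivAt (a := 0) (b := 1)
    (fun t _ => hasDerivAt_mul_one_sub_mul_pencilDet v q t)
    (((hc _).const_mul _).sub hs)
  rw [intervalIntegral.integral_sub ((hc _).const_mul _) hs,
    intervalIntegral.integral_const_mul,
    intervalIntegral.integral_finsetSum fun i _ => hc _] at h
  simp only [sub_self, mul_zero, zero_mul] at h
  linarith

theorem factorizationCount_of_subsingleton [Subsingleton α] (w : Perm α) :
    factorizationCount w = 1 := by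
  simp only [factorizationCount, inOneCycle_of_subsingleton, and_self, if_true, sum_const,
    smul_eq_mul, mul_one]
  simp

theorem pencilDet_of_subsingleton [Subsingleton α] (w : Perm α) (t : ℝ) : pencilDet w t = 1 := by
  cases isEmpty_or_nonempty α with
  | inl h => simp [pencilDet]
  | inr h =>
    obtain ⟨x⟩ := h
    rw [pencilDet, Matrix.det_eq_elem_of_subsingleton _ x]
    simp [pencil, eq_iff_true_of_subsingleton]

end count

/-- Boccara's formula: the number of factorizations of `w` into two full cycles is an integral of
`pencilDet w`. Both sides satisfy the same recursion under insertion of a letter. -/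
theorem factorizationCount_eq_integral {α : Type*} [Fintype α] [DecidableEq α] [Nonempty α]
    (w : Perm α) :
    (factorizationCount w : ℝ) =
      (Fintype.card α - 1)! * ∫ t in (0:ℝ)..1, pencilDet w t := by
  refine Fintype.induction_empty_option
    (P := fun α _ => ∀ [DecidableEq α] [Nonempty α] (w : Perm α), (factorizationCount w : ℝ) =
      (Fintype.card α - 1)! * ∫ t in (0:ℝ)..1, pencilDet w t) ?_ ?_ ?_ α w
  · intro α β _ e h _ _ w
    classical
    let _ : Fintype α := Fintype.ofEquiv β e.symm
    have : Nonempty α := e.nonempty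
    have h' := h (e.symm.permCongr w)
    have hw : e.permCongr (e.symm.permCongr w) = w := by ext; simp
    rw [← hw, factorizationCount_permCongr, h', Fintype.card_congr e]
    simp only [pencilDet_permCongr]
  · intro _ h
    exact absurd h (not_nonempty_iff.2 inferInstance)
  · intro α _ ih _ _ w
    classical
    cases isEmpty_or_nonempty α with
    | inl hα =>
      simp only [factorizationCount_of_subsingleton, pencilDet_of_subsingleton]
      simp
    | inr hα =>
      have hdec : ‹DecidableEq (Option α)› = Option.instDecidableEq := Subsingleton.elim _ _
      subst hdec
      obtain ⟨⟨i, v⟩, rfl⟩ := Perm.decomposeOption.symm.surjective w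
      simp only [Perm.decomposeOption_symm_apply]
      obtain ⟨m, hm⟩ : ∃ m, Fintype.card α = m + 1 :=
        Nat.exists_eq_succ_of_ne_zero Fintype.card_ne_zero
      cases i with
      | none =>
        simp only [swap_self, ← Perm.one_def, one_mul]
        rw [factorizationCount_optionCongr, Nat.cast_mul, ih]
        simp only [pencilDet_optionCongr, Fintype.card_option, hm, Nat.add_sub_cancel,
          Nat.factorial_succ, Nat.cast_mul]
        ring
      | some q =>
        rw [factorizationCount_swap_none_mul_optionCongr, Nat.cast_sum,
          sum_congr rfl fun i _ => ih _, ← mul_sum, ← card_mul_integral_pencilDet_swap_none]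
        simp only [Fintype.card_option, hm, Nat.add_sub_cancel, Nat.factorial_succ, Nat.cast_mul]
        ring

open Classical in
/-- The sum of `pencilDet w` over the permutations `w` that have all the letters of `K` in one
cycle. -/
noncomputable def pencilDetSum {α : Type*} [Fintype α] [DecidableEq α] (K : Finset α) (t : ℝ) : ℝ :=
  ∑ w : Perm α, if InOneCycle K w then pencilDet w t else 0

section sums
variable {α : Type*} [Fintype α] [DecidableEq α]

theorem pencilDetSum_map {β : Type*} [Fintype β] [DecidableEq β] (e : α ≃ β) (K : Finset α) :
    pencilDetSum (K.map e.toEmbedding) = pencilDetSum K := by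
  classical
  ext t
  rw [pencilDetSum, ← e.permCongr.sum_comp]
  refine sum_congr rfl fun w _ => ?_
  simp only [inOneCycle_map_permCongr, pencilDet_permCongr]

theorem pencilDetSum_univ_congr {β : Type*} [Fintype β] [DecidableEq β] (e : α ≃ β) :
    pencilDetSum (univ : Finset α) = pencilDetSum (univ : Finset β) := by
  rw [← map_univ_equiv e, pencilDetSum_map]

theorem deriv_pencilDetSum [∀ w : Perm α, ∀ K, Decidable (InOneCycle K w)] (K : Finset α) (t : ℝ) :
    deriv (pencilDetSum K) t =
      ∑ w : Perm α, if InOneCycle K w then deriv (pencilDet w) t else 0 := by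
  refine HasDerivAt.deriv (HasDerivAt.fun_sum fun w _ => ?_)
  split_ifs
  · exact (hasDerivAt_pencilDet w t).differentiableAt.hasDerivAt
  · exact hasDerivAt_const _ _

theorem sum_pencilDet_swap_none (v : Perm α) (t : ℝ) :
    ∑ q, pencilDet (swap none (some q) * v.optionCongr) t =
      Fintype.card α * (1 - 2 * t) * pencilDet v t - t * (1 - t) * deriv (pencilDet v) t := by
  obtain ⟨d, hd, htr⟩ := exists_hasDerivAt_pencilDet v t
  simp only [pencilDet_swap_none_mul_optionCongr, sum_sub_distrib, ← mul_sum, sum_const,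
    Finset.card_univ, nsmul_eq_mul, hd.deriv]
  have : ∑ q, (pencil v t).adjugate q q = (pencil v t).adjugate.trace := rfl
  rw [this, htr]
  ring

/-- Adding a letter outside `K` acts on `pencilDetSum K` by a first-order differential operator. -/
theorem pencilDetSum_map_some (K : Finset α) (t : ℝ) :
    pencilDetSum (K.map Function.Embedding.some) t =
      (1 + Fintype.card α - 2 * Fintype.card α * t) * pencilDetSum K t
        - t * (1 - t) * deriv (pencilDetSum K) t := by
  classical
  have h0 : ∀ v : Perm α, InOneCycle (K.map Function.Embedding.some) v.optionCongr ↔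
      InOneCycle K v := fun v => by
    simpa [swap_self, Perm.one_def.symm] using
      inOneCycle_map_some_swap_none_mul_optionCongr none v K
  rw [deriv_pencilDetSum, pencilDetSum, pencilDetSum, sum_perm_option, mul_sum, mul_sum,
    ← sum_sub_distrib]
  refine sum_congr rfl fun v _ => ?_
  simp only [h0, inOneCycle_map_some_swap_none_mul_optionCongr]
  split_ifs
  · rw [sum_pencilDet_swap_none, pencilDet_optionCongr]
    ring
  · simp

theorem pencilDetSum_univ_option [Nonempty α] (t : ℝ) :
    pencilDetSum (univ : Finset (Option α)) t =
      Fintype.card α * (1 - 2 * t) * pencilDetSum (univ : Finset α) t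
        - t * (1 - t) * deriv (pencilDetSum (univ : Finset α)) t := by
  classical
  rw [deriv_pencilDetSum, pencilDetSum, pencilDetSum, sum_perm_option, mul_sum, mul_sum,
    ← sum_sub_distrib]
  refine sum_congr rfl fun v _ => ?_
  simp only [inOneCycle_univ_optionCongr, inOneCycle_univ_swap_none_mul_optionCongr, ne_eq,
    reduceCtorEq, not_false_eq_true, true_and, if_false, zero_add]
  split_ifs
  · rw [sum_pencilDet_swap_none]
  · simp

end sums

/-- On the Bernstein monomials, `t * (1 - t)` times the derivative is multiplication by a linear
form; this is how the differential operators above act on coefficients. -/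
theorem hasDerivAt_pow_mul_one_sub_pow (m p : ℕ) (t : ℝ) :
    ∃ d, HasDerivAt (fun t : ℝ => t ^ m * (1 - t) ^ p) d t ∧
      t * (1 - t) * d = (m * (1 - t) - p * t) * (t ^ m * (1 - t) ^ p) := by
  have h1 := (hasDerivAt_pow m t).mul (((hasDerivAt_id t).const_sub 1).pow p)
  refine ⟨_, h1, ?_⟩
  simp only [id, Pi.pow_apply]
  have e1 : ∀ (m : ℕ) (x : ℝ), x * (m * x ^ (m - 1)) = m * x ^ m := by
    intro m x
    cases m with
    | zero => simp
    | succ m => simp [pow_succ]; ring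
  linear_combination (1 - t) * (1 - t) ^ p * e1 m t - t * t ^ m * e1 p (1 - t)

theorem pencilDetSum_univ (n : ℕ) {α : Type} [Fintype α] [DecidableEq α]
    (hn : Fintype.card α = n + 1) (t : ℝ) :
    pencilDetSum (univ : Finset α) t = n ! * ((1 - t) ^ (n + 1) - (-t) ^ (n + 1)) := by
  classical
  induction n generalizing α t with
  | zero =>
    have : Subsingleton α := Fintype.card_le_one_iff_subsingleton.1 hn.le
    simp only [pencilDetSum, pencilDet_of_subsingleton, inOneCycle_of_subsingleton, if_true,
      sum_const]
    simp
  | succ n ih =>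
    rw [pencilDetSum_univ_congr ((Fintype.equivFinOfCardEq hn).trans (finSuccEquiv (n + 1))),
      pencilDetSum_univ_option]
    have hf : pencilDetSum (univ : Finset (Fin (n + 1))) =
        fun t => n ! * (t ^ 0 * (1 - t) ^ (n + 1) + (-1 : ℝ) ^ n * (t ^ (n + 1) * (1 - t) ^ 0)) := by
      ext t
      rw [ih (by simp), neg_pow t]
      ring
    obtain ⟨d1, h1, e1⟩ := hasDerivAt_pow_mul_one_sub_pow 0 (n + 1) t
    obtain ⟨d2, h2, e2⟩ := hasDerivAt_pow_mul_one_sub_pow (n + 1) 0 t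
    have hd := ((h1.add (h2.const_mul ((-1 : ℝ) ^ n))).const_mul (n ! : ℝ)).deriv
    have hd' : deriv (pencilDetSum (univ : Finset (Fin (n + 1)))) t =
      n ! * (d1 + (-1 : ℝ) ^ n * d2) := by rw [hf, ← hd]; rfl
    rw [hd', hf, neg_pow t, Nat.factorial_succ, Fintype.card_fin]
    push_cast at e1 e2 ⊢
    linear_combination -(n ! : ℝ) * e1 - (n ! : ℝ) * (-1 : ℝ) ^ n * e2

/-! ### The Bernstein expansion of the summed determinants -/

/-- The coefficient `(-1) ^ (k + j - 1) * (k + j - 2)! / j!`, where `k = l + 2`; writing `k` this way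
avoids truncated subtraction. Up to a factor depending on `k` and on the number of letters, it is
the coefficient of `t ^ (k + j)` in the Bernstein expansion of `pencilDetSum K`. -/
noncomputable def blockCoeff (l j : ℕ) : ℝ := (-1) ^ (l + j + 1) * (l + j)! / j !

theorem blockCoeff_succ (l j : ℕ) :
    blockCoeff l (j + 1) * (j + 1) = -((l + j + 1) * blockCoeff l j) := by
  have : (j ! : ℝ) ≠ 0 := by positivity
  simp only [blockCoeff, ← add_assoc, Nat.factorial_succ]
  push_cast
  field_simp
  ring

/-- The closed form of `pencilDetSum K` for a set `K` of `l + 2` letters among `l + 2 + N`. -/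
noncomputable def pencilDetSumFormula (l N : ℕ) (t : ℝ) : ℝ :=
  (l + 2 + N)! / (l + 2) * (t ^ 0 * (1 - t) ^ (l + 2 + N)) +
    N * (l + 1 + N)! / (l + 2) * (t ^ 1 * (1 - t) ^ (l + 1 + N)) +
    (l + 1) * N ! * ∑ j ∈ range (N + 1), blockCoeff l j * (t ^ (l + 2 + j) * (1 - t) ^ (N - j))

theorem pencilDetSumFormula_succ (l N : ℕ) (t : ℝ) :
    pencilDetSumFormula l (N + 1) t =
      (1 + (l + 2 + N : ℕ) - 2 * (l + 2 + N : ℕ) * t) * pencilDetSumFormula l N t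
        - t * (1 - t) * deriv (pencilDetSumFormula l N) t := by
  obtain ⟨d0, h0, e0⟩ := hasDerivAt_pow_mul_one_sub_pow 0 (l + 2 + N) t
  obtain ⟨d1, h1, e1⟩ := hasDerivAt_pow_mul_one_sub_pow 1 (l + 1 + N) t
  choose d h e using fun j : ℕ => hasDerivAt_pow_mul_one_sub_pow (l + 2 + j) (N - j) t
  have hd : HasDerivAt (pencilDetSumFormula l N) ((l + 2 + N)! / (l + 2) * d0 +
      N * (l + 1 + N)! / (l + 2) * d1 +
      (l + 1) * N ! * ∑ j ∈ range (N + 1), blockCoeff l j * d j) t :=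
    ((h0.const_mul _).add (h1.const_mul _)).add
      ((HasDerivAt.fun_sum fun j _ => (h j).const_mul _).const_mul _)
  rw [hd.deriv]
  have hsum : ((N + 1 : ℕ) : ℝ) * ∑ j ∈ range (N + 2),
        blockCoeff l j * (t ^ (l + 2 + j) * (1 - t) ^ (N + 1 - j)) =
      (1 + (l + 2 + N : ℕ) - 2 * (l + 2 + N : ℕ) * t) *
        ∑ j ∈ range (N + 1), blockCoeff l j * (t ^ (l + 2 + j) * (1 - t) ^ (N - j))
      - t * (1 - t) * ∑ j ∈ range (N + 1), blockCoeff l j * d j := by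
    -- Split `N + 1 = (N + 1 - j) + j`: the first part comes from `1 - t`, the second from `t`.
    have hA : ∑ j ∈ range (N + 2), ((N + 1 : ℕ) - j : ℝ) *
          (blockCoeff l j * (t ^ (l + 2 + j) * (1 - t) ^ (N + 1 - j))) =
        ∑ j ∈ range (N + 1), (N + 1 - j : ℝ) * (1 - t) *
          (blockCoeff l j * (t ^ (l + 2 + j) * (1 - t) ^ (N - j))) := by
      rw [sum_range_succ, sub_self, zero_mul, add_zero]
      refine sum_congr rfl fun j hj => ?_
      rw [Nat.succ_sub (Nat.lt_succ_iff.1 (mem_range.1 hj)), pow_succ]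
      push_cast
      ring
    have hB : ∑ j ∈ range (N + 2), (j : ℝ) *
          (blockCoeff l j * (t ^ (l + 2 + j) * (1 - t) ^ (N + 1 - j))) =
        ∑ j ∈ range (N + 1), -(l + j + 1 : ℝ) * t *
          (blockCoeff l j * (t ^ (l + 2 + j) * (1 - t) ^ (N - j))) := by
      rw [sum_range_succ', Nat.cast_zero, zero_mul, add_zero]
      refine sum_congr rfl fun j hj => ?_
      rw [Nat.add_sub_add_right, ← add_assoc, pow_succ t]
      push_cast
      linear_combination t ^ (l + 2 + j) * t * (1 - t) ^ (N - j) * blockCoeff_succ l j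
    have hAB : ((N + 1 : ℕ) : ℝ) * ∑ j ∈ range (N + 2),
        blockCoeff l j * (t ^ (l + 2 + j) * (1 - t) ^ (N + 1 - j)) =
        ∑ j ∈ range (N + 2), ((N + 1 : ℕ) - j : ℝ) *
          (blockCoeff l j * (t ^ (l + 2 + j) * (1 - t) ^ (N + 1 - j))) +
        ∑ j ∈ range (N + 2), (j : ℝ) *
          (blockCoeff l j * (t ^ (l + 2 + j) * (1 - t) ^ (N + 1 - j))) := by
      rw [mul_sum, ← sum_add_distrib]
      exact sum_congr rfl fun j _ => by ring
    rw [hAB, hA, hB, mul_sum, mul_sum, ← sum_add_distrib, ← sum_sub_distrib]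
    refine sum_congr rfl fun j hj => ?_
    have ej := e j
    rw [Nat.cast_sub (Nat.lt_succ_iff.1 (mem_range.1 hj))] at ej
    push_cast at ej ⊢
    linear_combination blockCoeff l j * ej
  simp only [pencilDetSumFormula]
  have f1 : ((l + 2 + (N + 1))! : ℝ) = (l + 3 + N) * ((l + 2 + N) * (l + 1 + N)!) := by
    rw [show l + 2 + (N + 1) = (l + 1 + N) + 1 + 1 by ring, Nat.factorial_succ, Nat.factorial_succ]
    push_cast; ring
  have f2 : ((l + 2 + N)! : ℝ) = (l + 2 + N) * (l + 1 + N)! := by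
    rw [show l + 2 + N = (l + 1 + N) + 1 by ring, Nat.factorial_succ]
    push_cast; ring
  have f3 : ((l + 1 + (N + 1))! : ℝ) = (l + 2 + N) * (l + 1 + N)! := by
    rw [← f2]; congr 2; ring
  rw [f1, f2, f3, Nat.factorial_succ, Nat.cast_mul,
    show l + 2 + (N + 1) = l + 2 + N + 1 by ring, show l + 1 + (N + 1) = l + 1 + N + 1 by ring]
  rw [show l + 2 + N = l + 1 + N + 1 by ring] at e0 ⊢
  generalize ((l + 1 + N)! : ℝ) = F
  push_cast at e0 e1 hsum ⊢
  simp only [pow_succ (1 - t)] at e0 ⊢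
  generalize (1 - t) ^ (l + 1 + N) = y at *
  generalize ∑ j ∈ range (N + 1 + 1),
        blockCoeff l j * (t ^ (l + 2 + j) * (1 - t) ^ (N + 1 - j)) = s1 at *
  generalize ∑ j ∈ range (N + 1), blockCoeff l j * (t ^ (l + 2 + j) * (1 - t) ^ (N - j)) = s2 at *
  generalize ∑ j ∈ range (N + 1), blockCoeff l j * d j = s3 at *
  simp only [mul_div_assoc]
  generalize F / ((l : ℝ) + 2) = f at *
  linear_combination (l + 1) * N ! * hsum + (l + 2 + N) * f * e0 + N * f * e1

/-- Starting from `K = univ`, letters outside `K` are added one at a time. -/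
theorem pencilDetSum_eq_formula (l N : ℕ) {α : Type} [Fintype α] [DecidableEq α]
    (hα : Fintype.card α = l + 2 + N) (K : Finset α) (hK : #K = l + 2) :
    pencilDetSum K = pencilDetSumFormula l N := by
  induction N generalizing α with
  | zero =>
    have : K = univ := eq_univ_of_card K (by omega)
    ext t
    rw [this, pencilDetSum_univ (l + 1) hα, pencilDetSumFormula, neg_pow t]
    have hl : (l : ℝ) + 2 ≠ 0 := by positivity
    simp only [blockCoeff, Nat.factorial_succ, zero_add, sum_range_one, Nat.factorial_zero]
    push_cast
    field_simp
    ring_nf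
  | succ N ih =>
    obtain ⟨z, hz⟩ : ∃ z, z ∉ K := by
      by_contra! h
      have : K = univ := eq_univ_of_forall h
      rw [this, Finset.card_univ] at hK
      omega
    let e := optionSubtypeNe z
    let K' : Finset {x // x ≠ z} := K.subtype _
    have hmap : (K'.map Function.Embedding.some).map e.toEmbedding = K := by
      ext x
      simp only [K', mem_map, Function.Embedding.some_apply, mem_subtype, coe_toEmbedding, e]
      constructor
      · rintro ⟨_, ⟨y, hy, rfl⟩, rfl⟩
        simpa using hy
      · intro hx
        have hxz : x ≠ z := fun h => hz (h ▸ hx)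
        exact ⟨some ⟨x, hxz⟩, ⟨⟨x, hxz⟩, hx, rfl⟩, by simp⟩
    have hK' : #K' = l + 2 := by
      rw [← hK, ← hmap, card_map, card_map]
    have hc : Fintype.card {x // x ≠ z} = l + 2 + N := by
      have h1 := Fintype.card_congr e
      rw [Fintype.card_option] at h1
      omega
    have h := ih hc K' hK'
    ext t
    rw [← hmap, pencilDetSum_map, pencilDetSum_map_some, h, hc, pencilDetSumFormula_succ]

theorem integral_pow_mul_one_sub_pow (m p : ℕ) :
    ∫ t in (0:ℝ)..1, t ^ m * (1 - t) ^ p = m ! * p ! / (m + p + 1)! := by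
  induction p generalizing m with
  | zero =>
    have : ((m : ℝ) + 1) ≠ 0 := by positivity
    have h2 : (m ! : ℝ) ≠ 0 := by positivity
    simp [integral_pow, Nat.factorial_succ]
    field_simp
  | succ p ih =>
    have hc : ∀ m p : ℕ, IntervalIntegrable (fun t : ℝ => t ^ m * (1 - t) ^ p)
        MeasureTheory.volume 0 1 := fun m p =>
      (by fun_prop : Continuous fun t : ℝ => t ^ m * (1 - t) ^ p).intervalIntegrable _ _
    have h : (fun t : ℝ => t ^ m * (1 - t) ^ (p + 1)) =
        fun t => t ^ m * (1 - t) ^ p - t ^ (m + 1) * (1 - t) ^ p := by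
      ext t; ring
    rw [h, intervalIntegral.integral_sub (hc _ _) (hc _ _), ih, ih]
    have e : m + 1 + p + 1 = m + p + 1 + 1 := by ring
    rw [e, show m + (p + 1) + 1 = m + p + 1 + 1 by ring, Nat.factorial_succ (m + p + 1),
      Nat.factorial_succ m, Nat.factorial_succ p]
    have : ((m + p + 1)! : ℝ) ≠ 0 := by positivity
    push_cast
    field_simp
    ring

theorem integral_pencilDetSumFormula (l N : ℕ) :
    ∫ t in (0:ℝ)..1, pencilDetSumFormula l N t =
      (l + 2 + N)! / (l + 2) * (0 ! * (l + 2 + N)! / (0 + (l + 2 + N) + 1)!) +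
      N * (l + 1 + N)! / (l + 2) * (1 ! * (l + 1 + N)! / (1 + (l + 1 + N) + 1)!) +
      (l + 1) * N ! * ∑ j ∈ range (N + 1), blockCoeff l j *
        ((l + 2 + j)! * (N - j)! / (l + 2 + j + (N - j) + 1)!) := by
  have hc : ∀ (c : ℝ) (m p : ℕ), IntervalIntegrable (fun t : ℝ => c * (t ^ m * (1 - t) ^ p))
      MeasureTheory.volume 0 1 := fun c m p =>
    (by fun_prop : Continuous fun t : ℝ => c * (t ^ m * (1 - t) ^ p)).intervalIntegrable _ _
  have hs : Continuous fun t : ℝ => (l + 1) * N ! * ∑ j ∈ range (N + 1),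
      blockCoeff l j * (t ^ (l + 2 + j) * (1 - t) ^ (N - j)) := by fun_prop
  simp only [pencilDetSumFormula]
  rw [intervalIntegral.integral_add ((hc _ _ _).add (hc _ _ _)) (hs.intervalIntegrable _ _),
    intervalIntegral.integral_add (hc _ _ _) (hc _ _ _),
    intervalIntegral.integral_const_mul, intervalIntegral.integral_const_mul,
    intervalIntegral.integral_const_mul,
    intervalIntegral.integral_finsetSum fun j _ => hc _ _ _]
  simp only [intervalIntegral.integral_const_mul, integral_pow_mul_one_sub_pow]

/-- The alternating sum in the coalescence probability of `l + 2` letters among `l + 2 + N`; its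
terms come from integrating the Bernstein expansion. -/
noncomputable def alternatingSum (l N : ℕ) : ℝ :=
  ∑ j ∈ range (N + 1), blockCoeff l j * (l + 2 + j)! * (N - j)!

theorem integral_pencilDetSumFormula_div (l N : ℕ) :
    (∫ t in (0:ℝ)..1, pencilDetSumFormula l N t) / (l + 1 + N)! =
      1 / (l + 2) - 1 / ((l + 2 + N) * (l + 3 + N)) +
        (l + 1) * N ! * alternatingSum l N / ((l + 3 + N)! * (l + 1 + N)!) := by
  have hs : ∑ j ∈ range (N + 1), blockCoeff l j *
        (((l + 2 + j)! : ℝ) * (N - j)! / (l + 2 + j + (N - j) + 1)!) =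
      alternatingSum l N / (l + 3 + N)! := by
    rw [alternatingSum, sum_div]
    refine sum_congr rfl fun j hj => ?_
    have := mem_range.1 hj
    rw [show l + 2 + j + (N - j) + 1 = l + 3 + N by omega]
    ring
  rw [integral_pencilDetSumFormula, hs,
    show 0 + (l + 2 + N) + 1 = l + 3 + N by ring, show 1 + (l + 1 + N) + 1 = l + 3 + N by ring]
  have f2 : ((l + 2 + N)! : ℝ) = (l + 2 + N) * (l + 1 + N)! := by
    rw [show l + 2 + N = (l + 1 + N) + 1 by ring, Nat.factorial_succ]
    push_cast; ring
  have f3 : ((l + 3 + N)! : ℝ) = (l + 3 + N) * ((l + 2 + N) * (l + 1 + N)!) := by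
    rw [← f2, show l + 3 + N = (l + 2 + N) + 1 by ring, Nat.factorial_succ]
    push_cast; ring
  rw [f3, f2]
  have : ((l + 1 + N)! : ℝ) ≠ 0 := by positivity
  have h2 : (l : ℝ) + 2 ≠ 0 := by positivity
  have h3 : (l : ℝ) + 2 + N ≠ 0 := by positivity
  have h4 : (l : ℝ) + 3 + N ≠ 0 := by positivity
  simp only [Nat.factorial_zero, Nat.factorial_one, Nat.cast_one]
  field_simp
  ring

/-! ### The probability as an integral -/

theorem mem_nCycles_iff {n : ℕ} (σ : Perm (Fin n)) : σ ∈ nCycles n ↔ InOneCycle univ σ := by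
  classical
  simp only [nCycles, mem_filter]
  exact ⟨fun h x _ y _ => h.2.2 (Set.mem_univ x) (Set.mem_univ y),
    fun h => ⟨mem_univ _, σ.bijective.bijOn_univ,
      fun x _ y _ => h x (mem_univ x) y (mem_univ y)⟩⟩

/-- The number of `n`-cycles is the value of `pencilDetSum univ` at `t = 0`, where every
determinant is `1`. -/
theorem card_nCycles (n : ℕ) : #(nCycles (n + 1)) = n ! := by
  classical
  have h := pencilDetSum_univ n (Fintype.card_fin (n + 1)) 0
  have h1 : ∀ w : Perm (Fin (n + 1)), pencilDet w 0 = 1 := fun w => by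
    rw [pencilDet, show pencil w 0 = 1 by ext x y; simp [pencil, Matrix.one_apply], Matrix.det_one]
  have h2 : nCycles (n + 1) = univ.filter fun σ => InOneCycle univ σ := by
    ext σ; simp [mem_nCycles_iff]
  simp only [pencilDetSum, h1, sum_boole, sub_zero, one_pow, neg_zero, zero_pow (succ_ne_zero n),
    mul_one] at h
  rw [h2]
  exact_mod_cast h

/-- The first `k` letters. -/
def firstLetters (n k : ℕ) : Finset (Fin n) := univ.filter fun i => (i : ℕ) < k

theorem card_firstLetters {n k : ℕ} (h : k ≤ n) : #(firstLetters n k) = k := by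
  rw [firstLetters, Fin.card_filter_val_lt, min_eq_right h]

theorem coalesce_iff {n : ℕ} (k : ℕ) (w : Perm (Fin n)) :
    Coalesce k w ↔ InOneCycle (firstLetters n k) w := by
  simp only [Coalesce, InOneCycle, firstLetters, mem_filter, mem_univ, true_and]
  exact ⟨fun h x hx y hy => h x y hx hy, fun h x y hx hy => h x hx y hy⟩

open Classical in
theorem coalescenceProb_eq_sum (n k : ℕ) :
    coalescenceProb n k = (∑ w : Perm (Fin n),
      if InOneCycle (firstLetters n k) w then (factorizationCount w : ℝ) else 0) /
        (#(nCycles n) : ℝ) ^ 2 := by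
  have hc : (#(nCycles n) : ℝ) ≠ 0 := by
    exact_mod_cast (nCycles_nonempty n).card_pos.ne'
  have h1 : (randomProduct n).toOuterMeasure {π | Coalesce k π} =
      ∑ σ : Perm (Fin n), if InOneCycle univ σ then (#(nCycles n) : ENNReal)⁻¹ *
        ((#((nCycles n).filter fun τ => Coalesce k (σ * τ)) : ENNReal) / #(nCycles n)) else 0 := by
    rw [randomProduct, PMF.toOuterMeasure_bind_apply, tsum_fintype]
    refine sum_congr rfl fun σ _ => ?_
    rw [PMF.toOuterMeasure_map_apply, randomNCycle, PMF.toOuterMeasure_uniformOfFinset_apply,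
      PMF.uniformOfFinset_apply]
    simp only [mem_nCycles_iff]
    split_ifs
    · rfl
    · simp
  have h2 : coalescenceProb n k = ∑ σ : Perm (Fin n), if InOneCycle univ σ then
      (#(nCycles n) : ℝ)⁻¹ *
        ((#((nCycles n).filter fun τ => Coalesce k (σ * τ)) : ℝ) / #(nCycles n)) else 0 := by
    rw [coalescenceProb, h1, ENNReal.toReal_sum]
    · refine sum_congr rfl fun σ _ => ?_
      split_ifs <;> simp
    · intro σ _
      split_ifs
      · have : (#(nCycles n) : ENNReal) ≠ 0 := by
          exact_mod_cast (nCycles_nonempty n).card_pos.ne'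
        exact ENNReal.mul_ne_top (ENNReal.inv_ne_top.2 this)
          (ENNReal.div_ne_top (ENNReal.natCast_ne_top _) this)
      · simp
  have h3 : ∀ σ : Perm (Fin n), (#((nCycles n).filter fun τ => Coalesce k (σ * τ)) : ℝ) =
      ∑ w : Perm (Fin n), if InOneCycle (firstLetters n k) w ∧ InOneCycle univ (σ⁻¹ * w)
        then 1 else 0 := by
    intro σ
    rw [← Equiv.sum_comp (Equiv.mulLeft σ), sum_boole]
    congr 2
    ext τ
    simp [mem_nCycles_iff, coalesce_iff, and_comm]
  simp only [h2, h3, factorizationCount]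
  rw [eq_div_iff (pow_ne_zero 2 hc), sum_mul]
  have h4 : ∀ w : Perm (Fin n), (if InOneCycle (firstLetters n k) w then
      ((∑ σ : Perm (Fin n), if InOneCycle univ σ ∧ InOneCycle univ (σ⁻¹ * w) then 1 else 0 : ℕ) : ℝ)
        else 0) = ∑ σ : Perm (Fin n), if InOneCycle univ σ then
        (if InOneCycle (firstLetters n k) w ∧ InOneCycle univ (σ⁻¹ * w) then (1 : ℝ) else 0)
        else 0 := by
    intro w
    split_ifs with h
    · rw [Nat.cast_sum]
      refine sum_congr rfl fun σ _ => ?_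
      by_cases h5 : InOneCycle univ σ <;> simp [h, h5]
    · simp [h]
  rw [sum_congr rfl fun w _ => h4 w, sum_comm]
  refine sum_congr rfl fun σ _ => ?_
  split_ifs
  · field_simp
  · simp

theorem coalescenceProb_eq_integral (n k : ℕ) :
    coalescenceProb (n + 1) k =
      (∫ t in (0:ℝ)..1, pencilDetSum (firstLetters (n + 1) k) t) / n ! := by
  classical
  have hf : (n ! : ℝ) ≠ 0 := by positivity
  rw [coalescenceProb_eq_sum, card_nCycles]
  simp only [factorizationCount_eq_integral, pencilDetSum, Fintype.card_fin, Nat.add_sub_cancel]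
  rw [intervalIntegral.integral_finsetSum, div_eq_div_iff (pow_ne_zero 2 hf) hf, sum_mul, sum_mul]
  · refine sum_congr rfl fun w _ => ?_
    split_ifs
    · ring
    · simp
  · intro w _
    split_ifs
    · exact (continuous_pencilDet w).intervalIntegrable _ _
    · exact continuous_const.intervalIntegrable _ _

/-- A single letter always coalesces with itself. -/
theorem coalescenceProb_one (n : ℕ) : coalescenceProb n 1 = 1 := by
  have h : {π : Perm (Fin n) | Coalesce 1 π} = Set.univ := by
    refine Set.eq_univ_of_forall fun π i j hi hj => ?_
    rw [show i = j from Fin.ext (by omega)]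
  rw [coalescenceProb, h, (PMF.toOuterMeasure_apply_eq_one_iff _ _).2 (Set.subset_univ _)]
  rfl

/-! ### The recursion in the number of coalescing letters -/

theorem coalescenceProb_add_two (l N : ℕ) :
    coalescenceProb (l + 2 + N) (l + 2) =
      1 / (l + 2) - 1 / ((l + 2 + N) * (l + 3 + N)) +
        (l + 1) * N ! * alternatingSum l N / ((l + 3 + N)! * (l + 1 + N)!) := by
  rw [← integral_pencilDetSumFormula_div, ← pencilDetSum_eq_formula l N (Fintype.card_fin _)
    (firstLetters (l + 2 + N) (l + 2)) (card_firstLetters (by omega))]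
  have h := coalescenceProb_eq_integral (l + 1 + N) (l + 2)
  have e : l + 1 + N + 1 = l + 2 + N := by ring
  rwa [e] at h

theorem alternatingSum_succ_left (l N : ℕ) :
    alternatingSum (l + 1) N = ∑ j ∈ range (N + 2),
      j * (blockCoeff l j * (l + 2 + j)! * (N + 1 - j)!) := by
  rw [alternatingSum, sum_range_succ' _ (N + 1), Nat.cast_zero, zero_mul, add_zero]
  refine sum_congr rfl fun j _ => ?_
  have hb : blockCoeff (l + 1) j = (j + 1) * blockCoeff l (j + 1) := by
    have : (j ! : ℝ) ≠ 0 := by positivity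
    rw [blockCoeff, blockCoeff, show l + 1 + j = l + (j + 1) by ring, Nat.factorial_succ j]
    push_cast
    field_simp
  rw [hb, show l + 1 + 2 + j = l + 2 + (j + 1) by ring, Nat.add_sub_add_right]
  push_cast
  ring

/-- A telescoping sum that relates the alternating sums for `k = l + 2` and `k + 1` letters. -/
theorem sum_range_blockCoeff (l N J : ℕ) (hJ : J ≤ N + 1) :
    ∑ j ∈ range J, ((2 * l + 5 + N) * j + (l + 1) * (l + 3)) *
        (blockCoeff l j * (l + 2 + j)! * (N - j)!) =
      -(blockCoeff l J * J * (l + 2 + J)! * (N + 1 - J)!) := by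
  induction J with
  | zero => simp
  | succ J ih =>
    have hJN : J ≤ N := by omega
    rw [sum_range_succ, ih (by omega), Nat.succ_sub hJN, Nat.add_sub_add_right,
      Nat.factorial_succ (N - J), ← add_assoc, Nat.factorial_succ (l + 2 + J)]
    push_cast [Nat.cast_sub hJN]
    linear_combination (l + 2 + J + 1) * (l + 2 + J)! * (N - J)! * blockCoeff_succ l J

/-- A telescoping sum that evaluates the coalescence probability of two letters. -/
theorem sum_range_blockCoeff_zero (N J : ℕ) (hJ : J ≤ N + 1) :
    (N + 4) * ∑ j ∈ range J, blockCoeff 0 j * (2 + j)! * (N - j)! =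
      (-1) ^ J * (2 + J)! * (N + 1 - J)! - 2 * (N + 1)! := by
  have hb : ∀ j, blockCoeff 0 j = (-1) ^ (j + 1) := fun j => by
    have : (j ! : ℝ) ≠ 0 := by positivity
    rw [blockCoeff, zero_add]
    field_simp
  induction J with
  | zero => simp
  | succ J ih =>
    have hJN : J ≤ N := by omega
    rw [sum_range_succ, mul_add, ih (by omega), Nat.succ_sub hJN, Nat.add_sub_add_right,
      Nat.factorial_succ (N - J), ← add_assoc, Nat.factorial_succ (2 + J), hb]
    push_cast [Nat.cast_sub hJN]
    ring

/-- The recursion of the coalescence probability in the number of letters. -/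
theorem coalescenceProb_succ {n k : ℕ} (hk : 1 ≤ k) (hkn : k < n) :
    (n * (n + 1) - k * (k + 1) : ℝ) * coalescenceProb n (k + 1)
        + k * (k + 1) * coalescenceProb n k =
      n * (n + 1) / (k + 1) - (-1) ^ n * k := by
  obtain ⟨l, rfl⟩ := Nat.exists_eq_add_of_le' hk
  cases l with
  | zero =>
    obtain ⟨N, rfl⟩ := Nat.exists_eq_add_of_le' hkn
    have h := coalescenceProb_add_two 0 N
    have e : 0 + 2 + N = N + (0 + 1).succ := by ring
    rw [e] at h
    have hs := sum_range_blockCoeff_zero N (N + 1) le_rfl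
    have hS : alternatingSum 0 N = ∑ j ∈ range (N + 1), blockCoeff 0 j * (2 + j)! * (N - j)! := by
      simp [alternatingSum]
    rw [← hS, Nat.sub_self, Nat.factorial_zero] at hs
    rw [coalescenceProb_one, h]
    have f3 : ((0 + 3 + N)! : ℝ) = (N + 3) * ((N + 2) * (N + 1)!) := by
      rw [show 0 + 3 + N = (N + 1) + 1 + 1 by ring, Nat.factorial_succ, Nat.factorial_succ]
      push_cast; ring
    have f3' : ((2 + (N + 1))! : ℝ) = (N + 3) * ((N + 2) * (N + 1)!) := by
      rw [← f3]; congr 2; ring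
    have f1 : ((0 + 1 + N)! : ℝ) = (N + 1)! := by congr 2; ring
    have f0 : ((N + 1)! : ℝ) = (N + 1) * N ! := by rw [Nat.factorial_succ]; push_cast; ring
    rw [f3', f0] at hs
    rw [f3, f1, f0]
    have h0 : (N ! : ℝ) ≠ 0 := by positivity
    have hp : (-1 : ℝ) ^ (N + (0 + 1).succ) = (-1) ^ N := by simp [pow_succ]
    rw [hp]
    have hs' : (N + 4) * alternatingSum 0 N =
        -(N + 1) * N ! * ((-1) ^ N * (N + 3) * (N + 2) + 2) := by
      rw [hs]; push_cast; ring
    have hA : alternatingSum 0 N =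
        -(N + 1) * N ! * ((-1) ^ N * (N + 3) * (N + 2) + 2) / (N + 4) := by
      rw [← hs']; field_simp
    rw [hA]
    push_cast
    field_simp
    ring
  | succ l =>
    obtain ⟨N, rfl⟩ := Nat.exists_eq_add_of_le' hkn
    have h1 := coalescenceProb_add_two l (N + 1)
    have h2 := coalescenceProb_add_two (l + 1) N
    have e1 : l + 2 + (N + 1) = N + (l + 1 + 1).succ := by rw [Nat.succ_eq_add_one]; ring
    have e2 : l + 1 + 2 + N = N + (l + 1 + 1).succ := by rw [Nat.succ_eq_add_one]; ring
    rw [e1] at h1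
    rw [e2] at h2
    rw [show l + 1 + 1 + 1 = l + 1 + 2 by ring, h2, show l + 1 + 1 = l + 2 by ring, h1]
    have hs := sum_range_blockCoeff l (N + 1) (N + 2) le_rfl
    have hS : (2 * l + 6 + N) * alternatingSum (l + 1) N +
        (l + 1) * (l + 3) * alternatingSum l (N + 1) =
        -(blockCoeff l (N + 2) * (N + 2) * (l + 4 + N)!) := by
      rw [alternatingSum_succ_left, alternatingSum, mul_sum, mul_sum, ← sum_add_distrib]
      rw [show l + 2 + (N + 2) = l + 4 + N by ring, Nat.sub_self, Nat.factorial_zero] at hs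
      push_cast at hs
      rw [mul_one] at hs
      rw [← hs]
      refine sum_congr rfl fun j _ => ?_
      ring
    have hb : blockCoeff l (N + 2) * (N + 2) = -((-1) ^ (l + N) * (l + 2 + N)! / (N + 1)!) := by
      have : ((N + 1)! : ℝ) ≠ 0 := by positivity
      rw [blockCoeff, show l + (N + 2) = l + 2 + N by ring, Nat.factorial_succ (N + 1)]
      push_cast
      field_simp
      ring
    rw [hb] at hS
    have f1 : l + 3 + (N + 1) = l + 4 + N := by ring
    have f2 : l + 1 + (N + 1) = l + 2 + N := by ring
    have f3 : l + 1 + 3 + N = l + 4 + N := by ring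
    have f4 : l + 1 + 1 + N = l + 2 + N := by ring
    rw [f1, f2, f3, f4]
    have hp : (-1 : ℝ) ^ (N + (l + 2).succ) = -(-1) ^ (l + N) := by
      rw [Nat.succ_eq_add_one]; ring
    rw [hp]
    have g1 : ((N + 1)! : ℝ) = (N + 1) * N ! := by rw [Nat.factorial_succ]; push_cast; ring
    rw [g1] at hS ⊢
    have h0 : (N ! : ℝ) ≠ 0 := by positivity
    have h4 : ((l + 4 + N)! : ℝ) ≠ 0 := by positivity
    have h5 : ((l + 2 + N)! : ℝ) ≠ 0 := by positivity
    have hA : alternatingSum l (N + 1) =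
        ((-1) ^ (l + N) * (l + 2 + N)! / ((N + 1) * N !) * (l + 4 + N)! -
          (2 * l + 6 + N) * alternatingSum (l + 1) N) / ((l + 1) * (l + 3)) := by
      rw [eq_div_iff (by positivity)]
      linear_combination hS
    rw [hA]
    generalize (-1 : ℝ) ^ (l + N) = s
    have hn : (l : ℝ) + 3 + N ≠ 0 := by positivity
    have hn' : (l : ℝ) + 4 + N ≠ 0 := by positivity
    push_cast
    rw [show (l : ℝ) + 2 + (N + 1) = l + 3 + N by ring,
      show (l : ℝ) + 3 + (N + 1) = l + 4 + N by ring,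
      show (l : ℝ) + 1 + 2 = l + 3 by ring, show (l : ℝ) + 1 + 3 = l + 4 by ring,
      show (l : ℝ) + 2 + 1 = l + 3 by ring]
    field_simp
    ring

/-! ### The closed formula -/

/-- Telescoping over one residue class modulo `2`. -/
theorem sum_Icc_filter_sub_add_two (f : ℕ → ℝ) (n m : ℕ) :
    ∑ i ∈ (Icc 1 m).filter (fun i => ¬ i ≡ n [MOD 2]), (f i - f (i + 2)) =
      (if Even n then f 1 else f 2) -
        (if m + 1 ≡ n [MOD 2] then f (m + 2) else f (m + 1)) := by
  induction m with
  | zero =>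
    rcases Nat.even_or_odd n with h | h
    · have : ¬ 0 + 1 ≡ n [MOD 2] := by
        rw [Nat.ModEq, Nat.even_iff.1 h]; decide
      simp only [h, if_true, this, if_false]; simp
    · have : 0 + 1 ≡ n [MOD 2] := by
        rw [Nat.ModEq, Nat.odd_iff.1 h]
      simp only [Nat.not_even_iff_odd.2 h, if_true, this, if_false]; simp
  | succ m ih =>
    rw [← insert_Icc_right_eq_Icc_add_one (by omega), filter_insert]
    by_cases h : m + 1 ≡ n [MOD 2]
    · have h2 : ¬ m + 1 + 1 ≡ n [MOD 2] := by
        simp only [Nat.ModEq] at h ⊢; omega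
      simp only [h, not_true_eq_false, if_false, h2, ih, if_true]
    · have h2 : m + 1 + 1 ≡ n [MOD 2] := by
        simp only [Nat.ModEq] at h ⊢; omega
      rw [if_pos h, sum_insert (by simp), ih, if_neg h, if_pos h2]
      ring

/-- The coefficient `(2k-1).choose (k+i) / (2k).choose k` of the index `i` in the closed formula.
It vanishes for `1 ≤ k ≤ i`. -/
noncomputable def weight (k i : ℕ) : ℝ := ((2 * k - 1).choose (k + i) : ℝ) / ((2 * k).choose k : ℝ)

theorem weight_self (k : ℕ) (hk : 1 ≤ k) : weight k k = 0 := by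
  rw [weight, Nat.choose_eq_zero_of_lt (by omega)]
  simp

theorem choose_two_mul_succ (k : ℕ) :
    ((2 * (k + 1)).choose (k + 1) : ℝ) * (k + 1) = 2 * (2 * k + 1) * ((2 * k).choose k : ℝ) := by
  have := Nat.succ_mul_centralBinom_succ k
  rw [Nat.centralBinom, Nat.centralBinom] at this
  have h : ((k + 1 : ℕ) : ℝ) * ((2 * (k + 1)).choose (k + 1) : ℝ) =
      2 * (2 * k + 1) * ((2 * k).choose k : ℝ) := by exact_mod_cast this
  rw [← h]
  push_cast
  ring

theorem weight_succ (k i : ℕ) (hk : 1 ≤ k) (hi : i ≤ k) :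
    weight (k + 1) i * (k * (k + 1) - i * (i + 1)) = k * (k + 1) * weight k i := by
  have h1 : ((2 * k + 1 : ℕ) : ℝ) * (2 * k).choose (k + i) =
      (2 * k + 1).choose (k + i + 1) * ((k + i + 1 : ℕ) : ℝ) := by
    exact_mod_cast Nat.add_one_mul_choose_eq (2 * k) (k + i)
  have h2 : ((2 * k - 1).choose (k + i) : ℝ) * (2 * k) = (2 * k).choose (k + i) * (k - i) := by
    have := Nat.choose_mul_succ_eq (2 * k - 1) (k + i)
    rw [show 2 * k - 1 + 1 = 2 * k by omega, show 2 * k - (k + i) = k - i by omega] at this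
    rw [← Nat.cast_sub hi]
    exact_mod_cast this
  have h3 := choose_two_mul_succ k
  have p1 : ((2 * k).choose k : ℝ) ≠ 0 := by
    exact_mod_cast (Nat.choose_pos (by omega)).ne'
  have p2 : ((2 * (k + 1)).choose (k + 1) : ℝ) ≠ 0 := by
    exact_mod_cast (Nat.choose_pos (by omega)).ne'
  have p3 : (k : ℝ) + 1 ≠ 0 := by positivity
  have p4 : (2 * k + 1 : ℝ) ≠ 0 := by positivity
  rw [weight, weight, show 2 * (k + 1) - 1 = 2 * k + 1 by omega,
    show k + 1 + i = k + i + 1 by ring]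
  rw [show ((2 * (k + 1)).choose (k + 1) : ℝ) = 2 * (2 * k + 1) * ((2 * k).choose k : ℝ) / (k + 1)
    by rw [← h3]; field_simp]
  push_cast at h1
  field_simp
  linear_combination -(k - i) * h1 - (2 * k + 1) * h2

/-- The difference of the weights at distance two makes sums over one parity class telescope. -/
theorem weight_succ_eq_sub (k i : ℕ) (hk : 1 ≤ k) (hi1 : 1 ≤ i) (hi : i ≤ k) :
    (2 * i + 1) * weight (k + 1) i =
      (k + 1) / 2 * (weight k (i - 1) - weight k (i + 1)) := by
  have h1 : ((2 * k + 1 : ℕ) : ℝ) * (2 * k).choose (k + i) =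
      (2 * k + 1).choose (k + i + 1) * ((k + i + 1 : ℕ) : ℝ) := by
    exact_mod_cast Nat.add_one_mul_choose_eq (2 * k) (k + i)
  have h2 : ((2 * k).choose (k + i + 1) : ℝ) * (2 * k + 1) =
      (2 * k + 1).choose (k + i + 1) * (k - i) := by
    have := Nat.choose_mul_succ_eq (2 * k) (k + i + 1)
    rw [show 2 * k + 1 - (k + i + 1) = k - i by omega] at this
    rw [← Nat.cast_sub hi]
    exact_mod_cast this
  have h4 : ((2 * k).choose (k + i) : ℝ) =
      (2 * k - 1).choose (k + (i - 1)) + (2 * k - 1).choose (k + i) := by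
    have := Nat.choose_succ_succ (2 * k - 1) (k + (i - 1))
    rw [Nat.succ_eq_add_one, Nat.succ_eq_add_one, show 2 * k - 1 + 1 = 2 * k by omega,
      show k + (i - 1) + 1 = k + i by omega] at this
    exact_mod_cast this
  have h5 : ((2 * k).choose (k + i + 1) : ℝ) =
      (2 * k - 1).choose (k + i) + (2 * k - 1).choose (k + (i + 1)) := by
    have := Nat.choose_succ_succ (2 * k - 1) (k + i)
    rw [Nat.succ_eq_add_one, Nat.succ_eq_add_one, show 2 * k - 1 + 1 = 2 * k by omega] at this
    exact_mod_cast this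
  have h3 := choose_two_mul_succ k
  have p1 : ((2 * k).choose k : ℝ) ≠ 0 := by
    exact_mod_cast (Nat.choose_pos (by omega)).ne'
  have p3 : (k : ℝ) + 1 ≠ 0 := by positivity
  have p4 : (2 * k + 1 : ℝ) ≠ 0 := by positivity
  rw [weight, weight, weight, show 2 * (k + 1) - 1 = 2 * k + 1 by omega,
    show k + 1 + i = k + i + 1 by ring]
  rw [show ((2 * (k + 1)).choose (k + 1) : ℝ) = 2 * (2 * k + 1) * ((2 * k).choose k : ℝ) / (k + 1)
    by rw [← h3]; field_simp]
  push_cast at h1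
  field_simp
  linear_combination -h1 + h2 + (2 * k + 1) * (h4 - h5)

theorem weight_zero (k : ℕ) (hk : 1 ≤ k) : weight k 0 = 1 / 2 := by
  have h := Nat.choose_succ_succ (2 * k - 1) (k - 1)
  rw [Nat.succ_eq_add_one, Nat.succ_eq_add_one, show 2 * k - 1 + 1 = 2 * k by omega,
    show k - 1 + 1 = k by omega] at h
  have h2 : (2 * k - 1).choose (k - 1) = (2 * k - 1).choose k :=
    Nat.choose_symm_of_eq_add (by omega)
  have h3 : ((2 * k).choose k : ℝ) = 2 * ((2 * k - 1).choose k : ℝ) := by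
    rw [h, h2]; push_cast; ring
  have p1 : ((2 * k - 1).choose k : ℝ) ≠ 0 := by
    exact_mod_cast (Nat.choose_pos (by omega)).ne'
  rw [weight, h3, add_zero]
  field_simp

theorem weight_one (k : ℕ) (hk : 1 ≤ k) : weight k 1 = (k - 1) / (2 * (k + 1)) := by
  have h := Nat.choose_succ_right_eq (2 * k - 1) k
  rw [show 2 * k - 1 - k = k - 1 by omega] at h
  have h' : ((2 * k - 1).choose (k + 1) : ℝ) * (k + 1) = (2 * k - 1).choose k * (k - 1) := by
    have h1 : ((k - 1 : ℕ) : ℝ) = k - 1 := by rw [Nat.cast_sub hk, Nat.cast_one]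
    rw [← h1]
    exact_mod_cast h
  have h0 := weight_zero k hk
  rw [weight, add_zero] at h0
  have p1 : ((2 * k).choose k : ℝ) ≠ 0 := by
    exact_mod_cast (Nat.choose_pos (by omega)).ne'
  have p3 : (k : ℝ) + 1 ≠ 0 := by positivity
  rw [weight]
  rw [div_eq_div_iff p1 two_ne_zero] at h0
  rw [div_eq_div_iff p1 (by positivity)]
  linear_combination 2 * h' + (k - 1) * h0

theorem sum_weight_succ (n k : ℕ) (hk : 1 ≤ k) :
    4 * (-1 : ℝ) ^ n * ∑ i ∈ (Icc 1 k).filter (fun i => ¬ i ≡ n [MOD 2]),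
      (2 * i + 1) * weight (k + 1) i = 1 + (-1) ^ n * k := by
  have h1 : ∑ i ∈ (Icc 1 k).filter (fun i => ¬ i ≡ n [MOD 2]), (2 * i + 1) * weight (k + 1) i =
      ∑ i ∈ (Icc 1 k).filter (fun i => ¬ i ≡ n [MOD 2]),
        ((k + 1) / 2 * weight k (i - 1) - (k + 1) / 2 * weight k (i + 2 - 1)) := by
    refine sum_congr rfl fun i hi => ?_
    have := mem_Icc.1 (mem_filter.1 hi).1
    rw [weight_succ_eq_sub k i hk this.1 this.2]
    simp only [show i + 2 - 1 = i + 1 by omega]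
    ring
  have hz : ∀ j, k ≤ j → weight k j = 0 := fun j hj => by
    rw [weight, Nat.choose_eq_zero_of_lt (by omega)]
    simp
  rw [h1, sum_Icc_filter_sub_add_two (fun i => (k + 1) / 2 * weight k (i - 1)) n k]
  simp only [hz (k + 2 - 1) (by omega), hz (k + 1 - 1) (by omega), mul_zero, ite_self, sub_zero]
  have p3 : (k : ℝ) + 1 ≠ 0 := by positivity
  rcases Nat.even_or_odd n with h | h
  · rw [if_pos h, h.neg_one_pow, Nat.sub_self, weight_zero k hk]
    ring
  · rw [if_neg (Nat.not_even_iff_odd.2 h), h.neg_one_pow, weight_one k hk]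
    field_simp
    ring

theorem one_div_sub_one_div {n i : ℕ} (h : i < n) :
    1 / ((n : ℝ) + i + 1) - 1 / ((n : ℝ) - i) =
      -(2 * i + 1) / ((n : ℝ) * (n + 1) - i * (i + 1)) := by
  have h1 : (i : ℝ) < n := by exact_mod_cast h
  have h2 : (n : ℝ) - i ≠ 0 := by linarith
  have h3 : (n : ℝ) + i + 1 ≠ 0 := by positivity
  have h4 : (n : ℝ) * (n + 1) - i * (i + 1) = (n + i + 1) * (n - i) := by ring
  rw [h4]
  field_simp
  ring

/-- The closed formula satisfies the recursion `coalescenceProb_succ`: the factor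
`n (n + 1) - k (k + 1)` is split as `(n (n + 1) - i (i + 1)) - (k (k + 1) - i (i + 1))`, which
cancels one denominator or lowers `k`. -/
theorem closedSum_succ {n k : ℕ} (hk : 1 ≤ k) (hkn : k < n) :
    (n * (n + 1) - k * (k + 1) : ℝ) *
        (4 * (-1) ^ n * ∑ i ∈ (Icc 1 k).filter (fun i => ¬ i ≡ n [MOD 2]),
          weight (k + 1) i * (1 / ((n : ℝ) + i + 1) - 1 / ((n : ℝ) - i))) +
      k * (k + 1) * (4 * (-1) ^ n * ∑ i ∈ (Icc 1 (k - 1)).filter (fun i => ¬ i ≡ n [MOD 2]),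
          weight k i * (1 / ((n : ℝ) + i + 1) - 1 / ((n : ℝ) - i))) =
      -(1 + (-1) ^ n * k) := by
  have hext : ∑ i ∈ (Icc 1 (k - 1)).filter (fun i => ¬ i ≡ n [MOD 2]),
          weight k i * (1 / ((n : ℝ) + i + 1) - 1 / ((n : ℝ) - i)) =
      ∑ i ∈ (Icc 1 k).filter (fun i => ¬ i ≡ n [MOD 2]),
          weight k i * (1 / ((n : ℝ) + i + 1) - 1 / ((n : ℝ) - i)) := by
    refine sum_subset (filter_subset_filter _ (Icc_subset_Icc_right (by omega))) ?_
    intro i hi hi'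
    simp only [mem_filter, mem_Icc] at hi hi'
    have : i = k := by
      by_contra h
      exact hi' ⟨by omega, hi.2⟩
    rw [this, weight_self k hk, zero_mul]
  -- The sum for `k` may be extended to `i = k`, where the weight vanishes.
  rw [hext, ← sum_weight_succ n k hk]
  simp only [mul_sum]
  rw [← sum_add_distrib, ← sum_neg_distrib]
  refine sum_congr rfl fun i hi => ?_
  have hi' := mem_Icc.1 (mem_filter.1 hi).1
  have hw := weight_succ k i hk hi'.2
  have hin : (i : ℝ) + 1 ≤ n := by exact_mod_cast (by omega : i + 1 ≤ n)
  have hne : (n : ℝ) * (n + 1) - i * (i + 1) ≠ 0 := by nlinarith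
  rw [one_div_sub_one_div (by omega)]
  have hd : (2 * (i : ℝ) + 1) / ((n : ℝ) * (n + 1) - i * (i + 1)) *
      ((n : ℝ) * (n + 1) - i * (i + 1)) = 2 * i + 1 := div_mul_cancel₀ _ hne
  rw [neg_div]
  generalize (2 * (i : ℝ) + 1) / ((n : ℝ) * (n + 1) - i * (i + 1)) = q at *
  linear_combination 4 * (-1 : ℝ) ^ n * q * hw - 4 * (-1 : ℝ) ^ n * weight (k + 1) i * hd

theorem coalescenceProb_eq_weight {n k : ℕ} (hk : 1 ≤ k) (hkn : k ≤ n) :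
    coalescenceProb n k = 1 / k +
      4 * (-1) ^ n * ∑ i ∈ (Icc 1 (k - 1)).filter (fun i => ¬ i ≡ n [MOD 2]),
          weight k i * (1 / ((n : ℝ) + i + 1) - 1 / ((n : ℝ) - i)) := by
  induction k, hk using Nat.le_induction with
  | base => rw [coalescenceProb_one]; simp
  | succ k hk ih =>
    have h1 := coalescenceProb_succ hk hkn
    have h2 := closedSum_succ hk hkn
    rw [ih (by omega)] at h1
    have hkn' : (k : ℝ) + 1 ≤ n := by exact_mod_cast hkn
    have hne : (n : ℝ) * (n + 1) - k * (k + 1) ≠ 0 := by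
      have : (0 : ℝ) ≤ k := by positivity
      nlinarith
    refine mul_left_cancel₀ hne ?_
    rw [Nat.add_sub_cancel]
    have hk0 : (k : ℝ) ≠ 0 := by positivity
    have hk1 : (k : ℝ) + 1 ≠ 0 := by positivity
    rw [mul_add ((n : ℝ) * (n + 1) - k * (k + 1))]
    have e1 : (k : ℝ) * (k + 1) * (1 / k) = k + 1 := by field_simp
    have e2 : ((n : ℝ) * (n + 1) - k * (k + 1)) * (1 / ((k + 1 : ℕ) : ℝ)) =
      n * (n + 1) / (k + 1) - k := by push_cast; field_simp
    rw [e2]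
    linear_combination h1 - h2 - e1

theorem coalescenceProb_eq {n k : ℕ} (hk : 1 ≤ k) (hkn : k ≤ n) :
    coalescenceProb n k =
      1 / (k : ℝ) + 4 * (-1 : ℝ) ^ n / (Nat.choose (2 * k) k : ℝ) *
        ∑ i ∈ (Finset.Icc 1 (k - 1)).filter (fun i => ¬ i ≡ n [MOD 2]),
          (Nat.choose (2 * k - 1) (k + i) : ℝ) *
            (1 / ((n : ℝ) + (i : ℝ) + 1) - 1 / ((n : ℝ) - (i : ℝ))) := by
  rw [coalescenceProb_eq_weight hk hkn]
  congr 1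
  rw [mul_sum, mul_sum]
  refine sum_congr rfl fun i _ => ?_
  rw [weight]
  ring

open Polynomial in
/-- With the denominators written as `n (n + 1) - i (i + 1)`, the closed formula is visibly a
rational function of `n (n + 1)`; the common denominator is `∏ (X - i (i + 1))`, nonzero at
`n (n + 1)` because `i < n`. -/
theorem exists_polynomial_coalescenceProb {k : ℕ} (hk : 1 ≤ k) (r : ℕ) :
    ∃ P Q : ℚ[X], ∀ n : ℕ, k ≤ n → n ≡ r [MOD 2] →
      aeval ((n : ℝ) * ((n : ℝ) + 1)) Q ≠ 0 ∧
      coalescenceProb n k =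
        aeval ((n : ℝ) * ((n : ℝ) + 1)) P / aeval ((n : ℝ) * ((n : ℝ) + 1)) Q := by
  set s := (Icc 1 (k - 1)).filter (fun i => ¬ i ≡ r [MOD 2]) with hs
  let F : ℕ → ℚ[X] := fun i => X - C ((i : ℚ) * (i + 1))
  refine ⟨C (1 / (k : ℚ)) * ∏ i ∈ s, F i +
    C (4 * (-1) ^ r / ((2 * k).choose k : ℚ)) * ∑ i ∈ s,
      C (-((2 * k - 1).choose (k + i) : ℚ) * (2 * i + 1)) * ∏ j ∈ s.erase i, F j,
    ∏ i ∈ s, F i, fun n hkn hnr => ?_⟩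
  have hF : ∀ i, aeval ((n : ℝ) * ((n : ℝ) + 1)) (F i) = (n : ℝ) * (n + 1) - i * (i + 1) := by
    intro i
    simp [F]
  have hlt : ∀ i ∈ s, i < n := fun i hi => by
    have := mem_Icc.1 (mem_filter.1 hi).1
    omega
  have hF0 : ∀ i ∈ s, (n : ℝ) * (n + 1) - i * (i + 1) ≠ 0 := fun i hi => by
    have h1 : (i : ℝ) < n := by exact_mod_cast hlt i hi
    have h2 : (0 : ℝ) ≤ i := by positivity
    nlinarith
  have hQ : aeval ((n : ℝ) * ((n : ℝ) + 1)) (∏ i ∈ s, F i) =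
      ∏ i ∈ s, ((n : ℝ) * (n + 1) - i * (i + 1)) := by
    rw [map_prod]
    exact prod_congr rfl fun i _ => hF i
  have hQ0 : ∏ i ∈ s, ((n : ℝ) * (n + 1) - i * (i + 1)) ≠ 0 := prod_ne_zero_iff.2 hF0
  refine ⟨by rwa [hQ], ?_⟩
  have hsn : (Icc 1 (k - 1)).filter (fun i => ¬ i ≡ n [MOD 2]) = s := by
    refine filter_congr fun i _ => not_congr ?_
    exact ⟨fun h => h.trans hnr, fun h => h.trans hnr.symm⟩
  have hpow : (-1 : ℝ) ^ n = (-1) ^ r := by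
    rw [neg_one_pow_eq_pow_mod_two, hnr, ← neg_one_pow_eq_pow_mod_two]
  rw [coalescenceProb_eq hk hkn, hsn, hpow, eq_div_iff (by rwa [hQ]), hQ]
  simp only [map_add, map_mul, map_sum, map_prod, hF, aeval_C]
  rw [add_mul, mul_assoc _ (∑ i ∈ s, _), sum_mul]
  congr 1
  · simp
  · have : ∀ i ∈ s, ((2 * k - 1).choose (k + i) : ℝ) *
        (1 / ((n : ℝ) + i + 1) - 1 / ((n : ℝ) - i)) *
          ∏ j ∈ s, ((n : ℝ) * (n + 1) - j * (j + 1)) =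
        algebraMap ℚ ℝ (-((2 * k - 1).choose (k + i) : ℚ) * (2 * i + 1)) *
          ∏ j ∈ s.erase i, ((n : ℝ) * (n + 1) - j * (j + 1)) := by
      intro i hi
      rw [one_div_sub_one_div (hlt i hi), ← mul_prod_erase s _ hi]
      have := hF0 i hi
      simp only [map_mul, map_neg, map_add, map_natCast, map_ofNat, map_one]
      field_simp
    rw [sum_congr rfl this]
    simp only [map_mul, map_neg, map_add, map_div₀, map_pow, map_natCast, map_ofNat, map_one]

end CycleProduct

theorem theorem1 :
    (∀ n k : ℕ, 1 ≤ k → k ≤ n →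
      CycleProduct.coalescenceProb n k =
        1 / (k : ℝ) + 4 * (-1 : ℝ) ^ n / (Nat.choose (2 * k) k : ℝ) *
          ∑ i ∈ (Finset.Icc 1 (k - 1)).filter (fun i => ¬ i ≡ n [MOD 2]),
            (Nat.choose (2 * k - 1) (k + i) : ℝ) *
              (1 / ((n : ℝ) + (i : ℝ) + 1) - 1 / ((n : ℝ) - (i : ℝ)))) ∧
    (∀ k : ℕ, 1 ≤ k → ∀ r : ℕ, ∃ P Q : Polynomial ℚ, ∀ n : ℕ, k ≤ n → n ≡ r [MOD 2] →
      Polynomial.aeval ((n : ℝ) * ((n : ℝ) + 1)) Q ≠ 0 ∧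
      CycleProduct.coalescenceProb n k =
        Polynomial.aeval ((n : ℝ) * ((n : ℝ) + 1)) P /
          Polynomial.aeval ((n : ℝ) * ((n : ℝ) + 1)) Q) :=
  ⟨fun _ _ hk hkn => CycleProduct.coalescenceProb_eq hk hkn,
    fun _ hk r => CycleProduct.exists_polynomial_coalescenceProb hk r⟩
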